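/- Let $d_x,d_y\in\mathbb N$, let $\mathcal S$ be a finite set, and let $P$ be the transition matrix of an irreducible and aperiodic Markov chain on $\mathcal S$ with stationary distribution $\mu$. For $i,j\in\{1,2\}$ let $A_{ij}(\cdot)$ and $b_i(\cdot)$ be functions on $\mathcal S$ with values in real matrices and vectors, where $A_{11}(o)\in\mathbb R^{d_y\times d_y}$, $A_{12}(o)\in\mathbb R^{d_y\times d_x}$, $A_{21}(o)\in\mathbb R^{d_x\times d_y}$, $A_{22}(o)\in\mathbb R^{d_x\times d_x}$, $b_1(o)\in\mathbb R^{d_y}$, $b_2(o)\in\mathbb R^{d_x}$, and let $A_{ij}=\sum_{o}\mu(o)A_{ij}(o)$ and $b_i=\sum_o\mu(o)b_i(o)$ be their stationary means. Assume that $-A_{22}$ and $-\Delta$ are Hurwitz (all eigenvalues have negative real parts), where $\Delta=A_{11}-A_{12}A_{22}^{-1}A_{21}$, and put $$y^*=\Delta^{-1}(b_1-A_{12}A_{22}^{-1}b_2),\qquad x^*=A_{22}^{-1}(b_2-A_{21}y^*).$$ Let $(\mathcal F_k)_{k\ge0}$ be a filtration on a probability space, let $(O_k)_{k\ge 0}$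 be a Markov chain relative to $(\mathcal F_k)$ with transition matrix $P$ and any initial law, and let $x_0\in\mathbb R^{d_x}$ and $y_0\in\mathbb R^{d_y}$ be $\mathcal F_0$-measurable and square-integrable (for instance deterministic). Let $\alpha,\beta>0$ and $1/2<\xi<1$ be arbitrary, $\alpha_k=\alpha/(k+1)^{\xi}$, $\beta_k=\beta/(k+1)$, and for $k\ge0$ $$y_{k+1}=y_k+\beta_k\big(b_1(O_k)-A_{11}(O_k)y_k-A_{12}(O_k)x_k\big),$$ $$x_{k+1}=x_k+\alpha_k\big(b_2(O_k)-A_{21}(O_k)y_k-A_{22}(O_k)x_k\big).$$ Then $x_k\to x^*$ and $y_k\to y^*$ in mean square: all $x_k,y_k$ are square-integrable, and $\mathbb E\|x_k-x^*\|^2\to0$ and $\mathbb E\|y_k-y^*\|^2\to0$ as $k\to\infty$, where $\|\cdot\|$ is the Euclidean norm. -/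

import Mathlib

open MeasureTheory ProbabilityTheory Filter Topology

namespace TwoTimeScale

/-- The coefficients of the linear equations `A₁₁ y + A₁₂ x = b₁`, `A₂₁ y + A₂₂ x = b₂` in the
unknowns `x ∈ ℝ^dx` and `y ∈ ℝ^dy`. -/
structure LinSystem (dx dy : ℕ) where
  A₁₁ : Matrix (Fin dy) (Fin dy) ℝ
  A₁₂ : Matrix (Fin dy) (Fin dx) ℝ
  A₂₁ : Matrix (Fin dx) (Fin dy) ℝ
  A₂₂ : Matrix (Fin dx) (Fin dx) ℝ
  b₁ : EuclideanSpace ℝ (Fin dy)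
  b₂ : EuclideanSpace ℝ (Fin dx)

/-- A real square matrix is Hurwitz if all its (complex) eigenvalues have negative real parts. -/
def IsHurwitz {n : ℕ} (M : Matrix (Fin n) (Fin n) ℝ) : Prop :=
  ∀ z : ℂ, Module.End.HasEigenvalue (Matrix.toLin' (M.map Complex.ofReal)) z → z.re < 0

namespace LinSystem

variable {dx dy : ℕ} (L : LinSystem dx dy)

/-- The Schur complement `Δ = A₁₁ - A₁₂ A₂₂⁻¹ A₂₁`. -/
noncomputable def Δ : Matrix (Fin dy) (Fin dy) ℝ :=
  L.A₁₁ - L.A₁₂ * L.A₂₂⁻¹ * L.A₂₁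

/-- `y* = Δ⁻¹ (b₁ - A₁₂ A₂₂⁻¹ b₂)`. -/
noncomputable def yStar : EuclideanSpace ℝ (Fin dy) :=
  L.Δ⁻¹.toEuclideanLin (L.b₁ - (L.A₁₂ * L.A₂₂⁻¹).toEuclideanLin L.b₂)

/-- `x* = A₂₂⁻¹ (b₂ - A₂₁ y*)`. -/
noncomputable def xStar : EuclideanSpace ℝ (Fin dx) :=
  L.A₂₂⁻¹.toEuclideanLin (L.b₂ - L.A₂₁.toEuclideanLin L.yStar)

end LinSystem

/-- The averages of the noisy coefficients with respect to the weights `π` are those of `L`. -/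
def IsMean {S : Type*} [Fintype S] {dx dy : ℕ} (π : S → ℝ) (N : S → LinSystem dx dy)
    (L : LinSystem dx dy) : Prop :=
  ∑ s, π s • (N s).A₁₁ = L.A₁₁ ∧ ∑ s, π s • (N s).A₁₂ = L.A₁₂ ∧
  ∑ s, π s • (N s).A₂₁ = L.A₂₁ ∧ ∑ s, π s • (N s).A₂₂ = L.A₂₂ ∧
  ∑ s, π s • (N s).b₁ = L.b₁ ∧ ∑ s, π s • (N s).b₂ = L.b₂

/-- Every state has period one: the greatest common divisor of its possible return times is `1`. -/
def IsAperiodic {S : Type*} [Fintype S] [DecidableEq S] (P : Matrix S S ℝ) : Prop :=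
  ∀ (s : S) (d : ℕ), (∀ n : ℕ, 0 < n → 0 < (P ^ n) s s → d ∣ n) → d = 1

/-- The probability vector `π` is stationary for the transition matrix `P`. -/
def IsStationary {S : Type*} [Fintype S] (P : Matrix S S ℝ) (π : S → ℝ) : Prop :=
  π ∈ stdSimplex ℝ S ∧ Matrix.vecMul π P = π

/-- `O` is a Markov chain with transition matrix `P` relative to the filtration `ℱ`. The
initial law is arbitrary. -/
def IsMarkovChain {Ω S : Type*} {mΩ : MeasurableSpace Ω} [MeasurableSpace S]
    (μ : Measure Ω) (ℱ : Filtration ℕ mΩ) (P : Matrix S S ℝ) (O : ℕ → Ω → S) : Prop :=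
  (∀ k, Measurable[ℱ k] (O k)) ∧
  ∀ (k : ℕ) (s : S), μ⟦O (k + 1) ⁻¹' {s} | ℱ k⟧ =ᵐ[μ] fun ω => P (O k ω) s

/-- The iterates `(x_k, y_k)` of linear two-time-scale stochastic approximation along the
sample path `o`, with step sizes `a` for `x` and `b` for `y`:
`y_{k+1} = y_k + b_k (b₁(o_k) - A₁₁(o_k) y_k - A₁₂(o_k) x_k)`,
`x_{k+1} = x_k + a_k (b₂(o_k) - A₂₁(o_k) y_k - A₂₂(o_k) x_k)`. -/
noncomputable def iterates {S : Type*} {dx dy : ℕ} (N : S → LinSystem dx dy) (a b : ℕ → ℝ)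
    (o : ℕ → S) (x₀ : EuclideanSpace ℝ (Fin dx)) (y₀ : EuclideanSpace ℝ (Fin dy)) :
    ℕ → EuclideanSpace ℝ (Fin dx) × EuclideanSpace ℝ (Fin dy)
  | 0 => (x₀, y₀)
  | k + 1 =>
    let x := (iterates N a b o x₀ y₀ k).1
    let y := (iterates N a b o x₀ y₀ k).2
    (x + a k • ((N (o k)).b₂ - (N (o k)).A₂₁.toEuclideanLin y - (N (o k)).A₂₂.toEuclideanLin x),
     y + b k • ((N (o k)).b₁ - (N (o k)).A₁₁.toEuclideanLin y - (N (o k)).A₁₂.toEuclideanLin x))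

/-- The square-integrable random vectors `X_k` converge to the constant vector `c` in mean
square: `E ‖X_k - c‖² → 0`. -/
def TendstoInMeanSquare {Ω : Type*} {mΩ : MeasurableSpace Ω} {d : ℕ} (μ : Measure Ω)
    (X : ℕ → Ω → EuclideanSpace ℝ (Fin d)) (c : EuclideanSpace ℝ (Fin d)) : Prop :=
  (∀ k, MemLp (X k) 2 μ) ∧ Tendsto (fun k => ∫ ω, ‖X k ω - c‖ ^ 2 ∂μ) atTop (𝓝 0)

end TwoTimeScale

/-! The centered pair `w = (x - x*, y - y*)` follows a linear recursion with Markov-modulated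
coefficients, whose inhomogeneous terms have stationary mean zero because `(x*, y*)` solves the
averaged equations. The proof exhibits one quadratic Lyapunov function for the averaged recursion
and removes the Markov noise with Poisson equations.

Lyapunov function (`exists_lyapunov`, `exists_block_lyapunov`): with `p = x + A₂₂⁻¹ A₂₁ y` in
centered coordinates, the fast drift acts on `p` alone through `-A₂₂`, and the slow drift of `y` is
`-Δ y` up to a term in `p`. Since `b_k / a_k → 0`, the fast decay of `p` absorbs every cross term,
leaving a drift of at most `-c b_k ‖w‖²`.

Noise (`exists_poisson`, `exists_corrected_descent`): writing each centered coefficient as `g - P g`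
and adding a corrector of size `O(a_k)` to `Q w w` turns the first-order noise into a term of mean
zero, by the Markov property, plus `O(a_k² (1 + ‖w‖)²)`.

In expectation, with `n_k = E ‖w_k‖²`, the corrected function `u` satisfies `u_{k+1} ≤ u_k - c b_k
n_k + C a_k² (1 + n_k)`. As `a_k² = o(b_k)`, which is where `ξ > 1/2` enters, the error proportional
to `n_k` is absorbed by the drift, so no prior moment bound is needed. Divergence of `∑ b_k` then
forces `n_k → 0` (`tendsto_zero_of_perturbed_lyapunov`). -/

namespace TwoTimeScale

/-! ### Poisson equations for a finite irreducible chain. -/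

section Poisson

variable {S : Type*} [Fintype S] [DecidableEq S] {P : Matrix S S ℝ}

/-- Harmonic functions of an irreducible stochastic matrix are constant. -/
lemma eq_of_mulVec_eq_self (hP : P ∈ Matrix.rowStochastic ℝ S) (hirr : P.IsIrreducible)
    {f : S → ℝ} (hf : P.mulVec f = f) (i j : S) : f i = f j := by
  have hpow : ∀ k : ℕ, (P ^ k).mulVec f = f := by
    intro k
    induction k with
    | zero => simp
    | succ k ih => rw [pow_succ, ← Matrix.mulVec_mulVec, hf, ih]
  obtain ⟨m, -, hm⟩ := Finset.exists_max_image Finset.univ f ⟨i, Finset.mem_univ i⟩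
  suffices h : ∀ t, f t = f m by rw [h i, h j]
  intro t
  obtain ⟨k, -, hk⟩ :=
    (Matrix.isIrreducible_iff_exists_pow_pos hirr.nonneg).1 hirr m t
  have hPk : P ^ k ∈ Matrix.rowStochastic ℝ S := pow_mem hP k
  -- Maximum principle: `f m` is a weighted average of values at most `f m`, and `t` carries
  -- positive weight.
  have h0 : ∑ u, (P ^ k) m u * (f m - f u) = 0 := by
    have h1 := congrFun (hpow k) m
    simp only [Matrix.mulVec, dotProduct] at h1
    simp only [mul_sub, Finset.sum_sub_distrib, ← Finset.sum_mul,
      Matrix.sum_row_of_mem_rowStochastic hPk m, h1, one_mul, sub_self]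
  have h2 := (Finset.sum_eq_zero_iff_of_nonneg fun u _ =>
    mul_nonneg (Matrix.nonneg_of_mem_rowStochastic hPk)
      (sub_nonneg.2 (hm u (Finset.mem_univ u)))).1 h0 t (Finset.mem_univ t)
  rcases mul_eq_zero.1 h2 with h | h
  · exact absurd h hk.ne'
  · linarith

/-- The scalar Poisson equation of an irreducible stochastic matrix. -/
lemma exists_real_poisson (hP : P ∈ Matrix.rowStochastic ℝ S) (hirr : P.IsIrreducible)
    {π : S → ℝ} (hπ : IsStationary P π) (f : S → ℝ) (hf : ∑ s, π s * f s = 0) :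
    ∃ g : S → ℝ, g - P.mulVec g = f := by
  -- Fredholm alternative by dimension count: `range T` lies in the hyperplane `ker φ` by
  -- stationarity, and `ker T` is at most a line, so the two must agree.
  let T : (S → ℝ) →ₗ[ℝ] (S → ℝ) := LinearMap.id - P.mulVecLin
  let φ : (S → ℝ) →ₗ[ℝ] ℝ := ∑ s, π s • LinearMap.proj s
  have hφ : ∀ g, φ g = ∑ s, π s * g s := fun g => by simp [φ]
  have hsum : ∑ s, π s = 1 := hπ.1.2
  have hle : LinearMap.range T ≤ LinearMap.ker φ := by
    rintro _ ⟨g, rfl⟩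
    have h1 : dotProduct π (P.mulVec g) = dotProduct π g := by
      rw [Matrix.dotProduct_mulVec, hπ.2]
    simp only [dotProduct] at h1
    simp [T, hφ, mul_sub, h1]
  have hker : Module.finrank ℝ (LinearMap.ker T) ≤ 1 := by
    have : LinearMap.ker T ≤ ℝ ∙ (fun _ => 1 : S → ℝ) := by
      intro g hg
      have hg' : P.mulVec g = g := by
        have : g - P.mulVec g = 0 := hg
        exact (sub_eq_zero.1 this).symm
      rw [Submodule.mem_span_singleton]
      rcases isEmpty_or_nonempty S with h | ⟨⟨s₀⟩⟩
      · exact ⟨0, Subsingleton.elim _ _⟩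
      · exact ⟨g s₀, funext fun s => by simpa using eq_of_mulVec_eq_self hP hirr hg' s₀ s⟩
    exact (Submodule.finrank_mono this).trans ((finrank_span_le_card _).trans (by simp))
  have hφ0 : LinearMap.range φ = ⊤ := by
    rw [LinearMap.range_eq_top]
    intro c
    exact ⟨fun _ => c, by rw [hφ, ← Finset.sum_mul, hsum, one_mul]⟩
  have h1 := LinearMap.finrank_range_add_finrank_ker T
  have h2 := LinearMap.finrank_range_add_finrank_ker φ
  rw [hφ0, finrank_top, Module.finrank_self] at h2
  have heq : LinearMap.range T = LinearMap.ker φ :=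
    Submodule.eq_of_le_of_finrank_le hle (by omega)
  have hmem : f ∈ LinearMap.ker φ := by rw [LinearMap.mem_ker, hφ, hf]
  rw [← heq] at hmem
  exact hmem

/-- The vector-valued Poisson equation of an irreducible stochastic matrix. -/
lemma exists_poisson (hP : P ∈ Matrix.rowStochastic ℝ S) (hirr : P.IsIrreducible)
    {π : S → ℝ} (hπ : IsStationary P π) {F : Type*} [AddCommGroup F] [Module ℝ F]
    (f : S → F) (hf : ∑ s, π s • f s = 0) :
    ∃ g : S → F, ∀ s, g s - ∑ u, P s u • g u = f s := by
  -- Centered indicators suffice: a mean-zero `f` is their combination with coefficients `f t`.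
  have key : ∀ t : S, ∃ r : S → ℝ, r - P.mulVec r = fun s => (if s = t then 1 else 0) - π t := by
    intro t
    refine exists_real_poisson hP hirr hπ _ ?_
    simp only [mul_sub, Finset.sum_sub_distrib, ← Finset.sum_mul, hπ.1.2]
    simp
  choose r hr using key
  refine ⟨fun s => ∑ t, r t s • f t, fun s => ?_⟩
  have h1 : ∑ u, P s u • ∑ t, r t u • f t = ∑ t, (P.mulVec (r t)) s • f t := by
    simp only [Finset.smul_sum, Matrix.mulVec, dotProduct, Finset.sum_smul, smul_smul]
    exact Finset.sum_comm
  have h2 : ∀ t, r t s - (P.mulVec (r t)) s = (if s = t then 1 else 0) - π t :=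
    fun t => congrFun (hr t) s
  rw [h1, ← Finset.sum_sub_distrib]
  simp only [← sub_smul, h2]
  simp [sub_smul, hf]

end Poisson

/-! ### A scalar recursion with divergent step sum. -/

section Scalar

/-- A nonnegative sequence with `s_{k+1} ≤ (1 - b_k) s_k + b_k e_k`, where `b_k` is small and not
summable and `e_k → 0`, tends to zero. -/
lemma tendsto_zero_of_le_one_sub_mul_add {s b e : ℕ → ℝ} (hs : ∀ᶠ k in atTop, 0 ≤ s k)
    (hb0 : ∀ k, 0 ≤ b k) (hb : Tendsto b atTop (𝓝 0))
    (hbsum : Tendsto (fun n => ∑ k ∈ Finset.range n, b k) atTop atTop)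
    (he : Tendsto e atTop (𝓝 0))
    (hrec : ∀ᶠ k in atTop, s (k + 1) ≤ (1 - b k) * s k + b k * e k) :
    Tendsto s atTop (𝓝 0) := by
  have key : ∀ ε > 0, ∀ᶠ k in atTop, s k < ε := by
    intro ε hε
    obtain ⟨K, hK⟩ := eventually_atTop.1 ((hrec.and (hb.eventually_lt_const one_pos)).and
      (he.eventually_lt_const (half_pos hε)))
    -- The excess over `ε / 2` shrinks by `1 - b ≤ exp (-b)` at each step. The absolute value keeps
    -- the bound nonnegative when the initial excess is negative.
    have hstep : ∀ n, s (K + n) - ε / 2 ≤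
        |s K - ε / 2| * Real.exp (-(∑ k ∈ Finset.range (K + n), b k - ∑ k ∈ Finset.range K, b k)) := by
      intro n
      induction n with
      | zero => simpa using le_abs_self (s K - ε / 2)
      | succ n ih =>
        obtain ⟨⟨h1, h2⟩, h3⟩ := hK (K + n) (by omega)
        have hpos : 0 ≤ 1 - b (K + n) := by linarith
        have h4 : s (K + n + 1) - ε / 2 ≤ (1 - b (K + n)) * (s (K + n) - ε / 2) := by
          nlinarith [mul_le_mul_of_nonneg_left h3.le (hb0 (K + n))]
        refine h4.trans ((mul_le_mul_of_nonneg_left ih hpos).trans ?_)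
        rw [← add_assoc, Finset.sum_range_succ, mul_left_comm]
        refine mul_le_mul_of_nonneg_left ?_ (abs_nonneg _)
        rw [show -(∑ k ∈ Finset.range (K + n), b k + b (K + n) - ∑ k ∈ Finset.range K, b k)
          = -b (K + n) + -(∑ k ∈ Finset.range (K + n), b k - ∑ k ∈ Finset.range K, b k) by ring,
          Real.exp_add]
        exact mul_le_mul_of_nonneg_right (Real.one_sub_le_exp_neg _) (Real.exp_nonneg _)
    have hlim : Tendsto (fun m => |s K - ε / 2| *
        Real.exp (-(∑ k ∈ Finset.range m, b k - ∑ k ∈ Finset.range K, b k))) atTop (𝓝 0) := by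
      rw [← mul_zero |s K - ε / 2|]
      refine Tendsto.const_mul _ (Real.tendsto_exp_neg_atTop_nhds_zero.comp ?_)
      simpa only [sub_eq_add_neg] using tendsto_atTop_add_const_right atTop
        (-∑ k ∈ Finset.range K, b k) hbsum
    filter_upwards [hlim.eventually_lt_const (half_pos hε), eventually_ge_atTop K] with m hm hmK
    have := hstep (m - K)
    rw [Nat.add_sub_cancel' hmK] at this
    linarith
  rw [Metric.tendsto_nhds]
  intro ε hε
  filter_upwards [key ε hε, hs] with k h1 h2
  rw [Real.dist_eq, sub_zero, abs_of_nonneg h2]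
  exact h1

end Scalar

end TwoTimeScale

namespace TwoTimeScale

/-! ### Quadratic Lyapunov functions of Hurwitz matrices. -/

section Lyapunov

/-- The powers of an element of a complex Banach algebra whose spectrum lies in the open unit disc
tend to zero. -/
lemma tendsto_pow_zero_of_spectrum_lt_one {A : Type*} [NormedRing A] [NormedAlgebra ℂ A]
    [CompleteSpace A] (a : A) (ha : ∀ z ∈ spectrum ℂ a, ‖z‖ < 1) :
    Tendsto (fun k : ℕ => a ^ k) atTop (𝓝 0) := by
  rcases subsingleton_or_nontrivial A with h | h
  · exact tendsto_const_nhds.congr fun k => Subsingleton.elim _ _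
  have h1 : spectralRadius ℂ a < (1 : NNReal) :=
    spectrum.spectralRadius_lt_of_forall_lt a fun z hz => ha z hz
  obtain ⟨r, hr, hr1⟩ := ENNReal.lt_iff_exists_nnreal_btwn.1 h1
  have hr1' : r < 1 := by exact_mod_cast hr1
  -- Gelfand's formula: the `k`-th root of `‖a ^ k‖` is eventually below `r < 1`.
  have h2 := (spectrum.pow_nnnorm_pow_one_div_tendsto_nhds_spectralRadius a).eventually_lt_const hr
  have h3 : Tendsto (fun k : ℕ => (r : ℝ) ^ k) atTop (𝓝 0) :=
    tendsto_pow_atTop_nhds_zero_of_lt_one r.2 hr1'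
  refine squeeze_zero_norm' ?_ h3
  filter_upwards [h2, eventually_gt_atTop 0] with k hk hk0
  have hk' : ((‖a ^ k‖₊ : ENNReal) ^ (1 / (k : ℝ))) ^ (k : ℝ) ≤ (r : ENNReal) ^ (k : ℝ) :=
    ENNReal.rpow_le_rpow hk.le (Nat.cast_nonneg k)
  rw [← ENNReal.rpow_mul, one_div, inv_mul_cancel₀ (by positivity), ENNReal.rpow_one,
    ENNReal.rpow_natCast] at hk'
  exact_mod_cast hk'

/-- This places the eigenvalues of an Euler step `1 - t A` in the open unit disc, which reduces
stability in continuous time to stability in discrete time. -/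
lemma norm_one_sub_mul_lt_one {z : ℂ} {t : ℝ} (ht : 0 < t) (h : t * ‖z‖ ^ 2 < 2 * z.re) :
    ‖1 - t * z‖ < 1 := by
  have h1 : ‖1 - t * z‖ ^ 2 = 1 - t * (2 * z.re - t * ‖z‖ ^ 2) := by
    rw [← Complex.normSq_eq_norm_sq, ← Complex.normSq_eq_norm_sq, Complex.normSq_apply,
      Complex.normSq_apply]
    simp
    ring
  have h2 : 0 < t * (2 * z.re - t * ‖z‖ ^ 2) := mul_pos ht (by linarith)
  nlinarith [norm_nonneg (1 - t * z)]

lemma re_pos_of_mem_spectrum {n : ℕ} {A : Matrix (Fin n) (Fin n) ℝ} (hA : IsHurwitz (-A)) {z : ℂ}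
    (hz : z ∈ spectrum ℂ (A.map Complex.ofReal)) : 0 < z.re := by
  have h1 : -z ∈ spectrum ℂ ((-A).map Complex.ofReal) := by
    have : (-A).map Complex.ofReal = -(A.map Complex.ofReal) := by ext; simp
    rw [this, ← spectrum.neg_eq]
    simpa using hz
  rw [← Matrix.spectrum_toLin'] at h1
  have := hA _ (Module.End.hasEigenvalue_iff_mem_spectrum.2 h1)
  simpa using this

open scoped Pointwise in
/-- If `-A` is Hurwitz, then the powers of `1 - t A` tend to zero for some `t > 0`. -/
lemma exists_tendsto_pow_one_sub_smul {n : ℕ} {A : Matrix (Fin n) (Fin n) ℝ}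
    (hA : IsHurwitz (-A)) :
    ∃ t : ℝ, 0 < t ∧ Tendsto (fun k : ℕ => (1 - t • A) ^ k) atTop (𝓝 0) := by
  let _ : NormedRing (Matrix (Fin n) (Fin n) ℂ) := Matrix.linftyOpNormedRing
  let _ : NormedAlgebra ℂ (Matrix (Fin n) (Fin n) ℂ) := Matrix.linftyOpNormedAlgebra
  have hcomplete : CompleteSpace (Matrix (Fin n) (Fin n) ℂ) := FiniteDimensional.complete ℂ _
  set C := A.map Complex.ofReal with hC
  have hfin : (spectrum ℂ C).Finite := by
    rw [← Matrix.spectrum_toLin']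
    exact Module.End.finite_spectrum _
  -- The spectrum is finite, so one small `t` serves all eigenvalues.
  have hev : ∀ᶠ t : ℝ in 𝓝[>] 0, ∀ z ∈ spectrum ℂ C, t * ‖z‖ ^ 2 < 2 * z.re := by
    rw [Filter.eventually_all_finite hfin]
    intro z hz
    have hpos : (0 : ℝ) * ‖z‖ ^ 2 < 2 * z.re := by
      have := re_pos_of_mem_spectrum hA hz
      linarith
    have hcont : Tendsto (fun t : ℝ => t * ‖z‖ ^ 2) (𝓝[>] 0) (𝓝 (0 * ‖z‖ ^ 2)) :=
      (tendsto_id.mul_const _).mono_left nhdsWithin_le_nhds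
    exact hcont.eventually_lt_const hpos
  obtain ⟨t, ht, ht0⟩ := (hev.and self_mem_nhdsWithin).exists
  refine ⟨t, ht0, ?_⟩
  have h1 : Tendsto (fun k : ℕ => (1 - (t : ℂ) • C) ^ k) atTop (𝓝 0) := by
    refine tendsto_pow_zero_of_spectrum_lt_one _ fun w hw => ?_
    have ht' : (t : ℂ) ≠ 0 := by exact_mod_cast (ht0 : 0 < t).ne'
    have h2 : w ∈ ({1} : Set ℂ) - spectrum ℂ ((t : ℂ) • C) := by
      have := spectrum.singleton_sub_eq ((t : ℂ) • C) (1 : ℂ)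
      rw [this]
      simpa using hw
    obtain ⟨_, rfl, v, hv, rfl⟩ := h2
    have h3 : spectrum ℂ ((t : ℂ) • C) = (Units.mk0 (t : ℂ) ht') • spectrum ℂ C :=
      spectrum.unit_smul_eq_smul C (Units.mk0 (t : ℂ) ht')
    rw [h3] at hv
    obtain ⟨z, hz, rfl⟩ := hv
    exact norm_one_sub_mul_lt_one ht0 (ht z hz)
  have hmap : ∀ k : ℕ, ((1 - t • A) ^ k).map Complex.ofRealHom = (1 - (t : ℂ) • C) ^ k := by
    intro k
    rw [← RingHom.mapMatrix_apply, map_pow, map_sub, map_one]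
    congr 2
    ext i j
    simp [C]
  refine tendsto_pi_nhds.2 fun i => tendsto_pi_nhds.2 fun j => ?_
  have h4 : Tendsto (fun k : ℕ => ((1 - (t : ℂ) • C) ^ k) i j) atTop (𝓝 0) :=
    ((continuous_id.matrix_elem i j).tendsto' 0 0 rfl).comp h1
  have h5 := (Complex.continuous_re.tendsto' 0 0 rfl).comp h4
  refine h5.congr fun k => ?_
  rw [Function.comp_apply, ← hmap, Matrix.map_apply]
  exact Complex.ofReal_re _

/-- Lyapunov's theorem: if `-A` is Hurwitz, then `A` is coercive for some inner product. -/
lemma exists_lyapunov {n : ℕ} {A : Matrix (Fin n) (Fin n) ℝ} (hA : IsHurwitz (-A)) :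
    ∃ (Q : EuclideanSpace ℝ (Fin n) →L[ℝ] EuclideanSpace ℝ (Fin n) →L[ℝ] ℝ) (c : ℝ), 0 < c ∧
      (∀ v w, Q v w = Q w v) ∧ (∀ v, ‖v‖ ^ 2 ≤ Q v v) ∧
      ∀ v, c * ‖v‖ ^ 2 ≤ Q v (A.toEuclideanLin v) := by
  obtain ⟨t, ht, hlim⟩ := exists_tendsto_pow_one_sub_smul hA
  let T := Matrix.toEuclideanCLM (n := Fin n) (𝕜 := ℝ)
  set B := T (1 - t • A) with hB
  have hBv : ∀ v, B v = v - t • A.toEuclideanLin v := by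
    intro v
    have : B = 1 - t • T A := by rw [hB, map_sub, map_one, map_smul]
    rw [this]
    rfl
  have hpow : Tendsto (fun k : ℕ => B ^ k) atTop (𝓝 0) := by
    have hcont : Continuous T.toAlgEquiv.toLinearMap := LinearMap.continuous_of_finiteDimensional _
    have := (hcont.tendsto' 0 0 (map_zero _)).comp hlim
    refine this.congr fun k => ?_
    exact map_pow T (1 - t • A) k
  have hsmall : ∀ᶠ k in atTop, ‖B ^ k‖ < 1 / 2 :=
    (tendsto_zero_iff_norm_tendsto_zero.1 hpow).eventually_lt_const (by norm_num)
  obtain ⟨K, hK, hK0⟩ := (hsmall.and (eventually_gt_atTop 0)).exists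
  -- A truncation of the discrete Lyapunov series `∑ (B ^ k)ᵀ B ^ k`. The sum telescopes along `B`,
  -- and `‖B ^ K‖ < 1 / 2` leaves a decrease of at least `3 / 4 * ‖v‖ ^ 2`. Expanding with `B = 1 -
  -- t A` bounds this by `2 t Q(v, A v)`, hence the constant `3 / (8 t)`.
  let Q : EuclideanSpace ℝ (Fin n) →L[ℝ] EuclideanSpace ℝ (Fin n) →L[ℝ] ℝ :=
    ∑ k ∈ Finset.range K, (innerSL ℝ).bilinearComp (B ^ k) (B ^ k)
  have hQ : ∀ v w, Q v w = ∑ k ∈ Finset.range K, inner ℝ ((B ^ k) v) ((B ^ k) w) := by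
    intro v w
    simp [Q]
  have hQs : ∀ v, Q v v = ∑ k ∈ Finset.range K, ‖(B ^ k) v‖ ^ 2 := by
    intro v
    simp [hQ]
  have hsymm : ∀ v w, Q v w = Q w v := by
    intro v w
    simp only [hQ, real_inner_comm]
  refine ⟨Q, 3 / (8 * t), by positivity, hsymm, ?_, ?_⟩
  · intro v
    rw [hQs]
    refine le_trans ?_ (Finset.single_le_sum (fun k _ => by positivity) (Finset.mem_range.2 hK0))
    simp
  · intro v
    have h1 : Q (B v) (B v) + ‖v‖ ^ 2 = Q v v + ‖(B ^ K) v‖ ^ 2 := by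
      have e1 := Finset.sum_range_succ (fun k => ‖(B ^ k) v‖ ^ 2) K
      rw [Finset.sum_range_succ'] at e1
      simp only [hQs]
      simpa [pow_succ] using e1
    have h2 : ‖(B ^ K) v‖ ≤ 1 / 2 * ‖v‖ :=
      ((B ^ K).le_opNorm v).trans (mul_le_mul_of_nonneg_right hK.le (norm_nonneg v))
    have h3 : ‖(B ^ K) v‖ ^ 2 ≤ 1 / 4 * ‖v‖ ^ 2 := by
      nlinarith [norm_nonneg ((B ^ K) v), norm_nonneg v]
    have h4 : Q (B v) (B v) = Q v v - 2 * t * Q v (A.toEuclideanLin v)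
        + t ^ 2 * Q (A.toEuclideanLin v) (A.toEuclideanLin v) := by
      rw [hBv]
      simp only [map_sub, map_smul, sub_apply, smul_apply,
        smul_eq_mul, hsymm (A.toEuclideanLin v) v]
      ring
    have h5 : 0 ≤ Q (A.toEuclideanLin v) (A.toEuclideanLin v) := by
      rw [hQs]
      exact Finset.sum_nonneg fun k _ => by positivity
    have h6 : 3 / 4 * ‖v‖ ^ 2 ≤ 2 * t * Q v (A.toEuclideanLin v) := by
      nlinarith [mul_nonneg (sq_nonneg t) h5]
    rw [div_mul_eq_mul_div, div_le_iff₀ (by positivity)]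
    linarith

/-- If `-A` is Hurwitz, then `A` is invertible. -/
lemma isUnit_det_of_isHurwitz_neg {n : ℕ} {A : Matrix (Fin n) (Fin n) ℝ}
    (hA : IsHurwitz (-A)) : IsUnit A.det := by
  obtain ⟨Q, c, hc, -, -, hcoer⟩ := exists_lyapunov hA
  rw [isUnit_iff_ne_zero]
  intro h0
  obtain ⟨v, hv, hAv⟩ := Matrix.exists_mulVec_eq_zero_iff.2 h0
  have h1 := hcoer (WithLp.toLp 2 v)
  have h2 : A.toEuclideanLin (WithLp.toLp 2 v) = 0 := by
    rw [Matrix.toLpLin_toLp, Matrix.toLin'_apply, hAv]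
    rfl
  rw [h2, map_zero] at h1
  have h3 : 0 < ‖WithLp.toLp 2 v‖ := norm_pos_iff.2 fun h => hv (by simpa using h)
  nlinarith [mul_pos hc (pow_pos h3 2)]

end Lyapunov

end TwoTimeScale

namespace TwoTimeScale

/-! ### From a perturbed descent inequality to convergence. -/

section PerturbedLyapunov

/-- A sequence `n_k ≥ 0` tends to zero if it is comparable, up to small errors, to a sequence `u_k`
which decreases by `b_k n_k` up to errors of order `a_k² (1 + n_k)`, where `a_k² = o(b_k)`. -/
lemma tendsto_zero_of_perturbed_lyapunov {u n a b : ℕ → ℝ} {c C : ℝ} (hc : 0 < c) (hC : 0 < C)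
    (hn : ∀ k, 0 ≤ n k) (hb0 : ∀ k, 0 < b k)
    (ha : Tendsto a atTop (𝓝 0)) (hb : Tendsto b atTop (𝓝 0))
    (hab : Tendsto (fun k => a k ^ 2 / b k) atTop (𝓝 0))
    (hbsum : Tendsto (fun n => ∑ k ∈ Finset.range n, b k) atTop atTop)
    (hda : ∀ k, a (k + 1) - a k ≤ C * a k ^ 2)
    (hlow : ∀ k, c * n k - C * a k * (1 + n k) ≤ u k)
    (hupp : ∀ k, u k ≤ C * n k + C * a k * (1 + n k))
    (hrec : ∀ᶠ k in atTop, u (k + 1) ≤ u k - c * b k * n k + C * a k ^ 2 * (1 + n k)) :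
    Tendsto n atTop (𝓝 0) := by
  -- The shift compensates the possible negativity of `u`, of order `a k`; `hda` makes its
  -- increments harmless.
  set s : ℕ → ℝ := fun k => u k + C * a k with hs
  -- Since eventually `s ≤ 2 C (n + a)`, the drift `c b n` is at least `2 c' b s - c b a`. One half
  -- of `2 c' b s` absorbs the error `C a² n`, the other half gives the contraction.
  set c' := c / (4 * C) with hc'
  have hc'0 : 0 < c' := by positivity
  have hCc : c = 4 * C * c' := by rw [hc']; field_simp
  have ev1 : ∀ᶠ k in atTop, C * a k < c / 2 := by
    have : Tendsto (fun k => C * a k) atTop (𝓝 0) := by simpa using ha.const_mul C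
    exact this.eventually_lt_const (by positivity)
  have ev2 : ∀ᶠ k in atTop, a k < 1 := ha.eventually_lt_const one_pos
  have ev3 : ∀ᶠ k in atTop, C * (2 / c) * (a k ^ 2 / b k) < c' := by
    have : Tendsto (fun k => C * (2 / c) * (a k ^ 2 / b k)) atTop (𝓝 0) := by
      simpa using hab.const_mul (C * (2 / c))
    exact this.eventually_lt_const hc'0
  have hns : ∀ᶠ k in atTop, n k ≤ 2 / c * s k := by
    filter_upwards [ev1] with k h1
    have h2 := hlow k
    have h3 : C * a k * n k ≤ c / 2 * n k := mul_le_mul_of_nonneg_right h1.le (hn k)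
    have h4 : c / 2 * n k ≤ s k := by simp only [hs]; linarith
    rw [div_mul_eq_mul_div, le_div_iff₀ hc]
    linarith
  have hs0 : ∀ᶠ k in atTop, 0 ≤ s k := by
    filter_upwards [hns] with k h
    have := (hn k).trans h
    exact nonneg_of_mul_nonneg_right this (by positivity)
  have hstep : ∀ᶠ k in atTop, s (k + 1) ≤ (1 - c' * b k) * s k +
      c' * b k * ((c * a k + C * (C + 1) * (a k ^ 2 / b k)) / c') := by
    filter_upwards [hrec, ev1, ev2, ev3, hns, hs0] with k h h1 h2 h3 h4 h5
    have hbk := hb0 k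
    have e1 : s k ≤ 2 * C * n k + 2 * C * a k := by
      have := hupp k
      have h6 : C * a k * n k ≤ C * n k := by
        have := mul_le_mul_of_nonneg_left h2.le (mul_nonneg hC.le (hn k))
        linarith
      simp only [hs]
      linarith
    have e2 : 2 * c' * b k * s k ≤ c * b k * n k + c * b k * a k := by
      have := mul_le_mul_of_nonneg_left e1 (by positivity : 0 ≤ 2 * c' * b k)
      rw [hCc]
      linarith
    have e3 : C * a k ^ 2 * n k ≤ c' * b k * s k := by
      have f1 : C * a k ^ 2 * n k ≤ C * a k ^ 2 * (2 / c * s k) :=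
        mul_le_mul_of_nonneg_left h4 (by positivity)
      have f2 : C * (2 / c) * (a k ^ 2 / b k) * (b k * s k) ≤ c' * (b k * s k) :=
        mul_le_mul_of_nonneg_right h3.le (by positivity)
      have f3 : C * (2 / c) * (a k ^ 2 / b k) * (b k * s k) = C * a k ^ 2 * (2 / c * s k) := by
        field_simp
      linarith
    have e4 := mul_le_mul_of_nonneg_left (hda k) hC.le
    have e5 : c' * b k * ((c * a k + C * (C + 1) * (a k ^ 2 / b k)) / c')
        = c * b k * a k + C * (C + 1) * a k ^ 2 := by
      field_simp
    rw [e5]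
    simp only [hs] at e2 e3 ⊢
    linarith
  have hslim : Tendsto s atTop (𝓝 0) := by
    refine tendsto_zero_of_le_one_sub_mul_add hs0 (fun k => by have := hb0 k; positivity) ?_ ?_ ?_
      hstep
    · simpa using hb.const_mul c'
    · simp only [← Finset.mul_sum]
      exact hbsum.const_mul_atTop hc'0
    · simpa using ((ha.const_mul c).add (hab.const_mul (C * (C + 1)))).div_const c'
  refine squeeze_zero' (Eventually.of_forall hn) hns ?_
  simpa using hslim.const_mul (2 / c)

end PerturbedLyapunov

/-! ### The Markov property under the integral. -/

section Markov

variable {S Ω : Type*} [MeasurableSpace S] {mΩ : MeasurableSpace Ω} {μ : Measure Ω} {P : Matrix S S ℝ} {ℱ : Filtration ℕ mΩ}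
  {O : ℕ → Ω → S}

lemma IsMarkovChain.measurable (hO : IsMarkovChain μ ℱ P O) (k : ℕ) : Measurable (O k) :=
  (hO.1 k).mono (ℱ.le k) le_rfl

/-- The Markov property for integrals: averaging over the next state amounts to applying the
transition matrix. -/
lemma IsMarkovChain.integral_succ [Fintype S] [MeasurableSingletonClass S] [IsProbabilityMeasure μ]
    (hO : IsMarkovChain μ ℱ P O) (k : ℕ) {F : S → Ω → ℝ} (hF : ∀ s, Measurable[ℱ k] (F s)) (hint : ∀ s, Integrable (F s) μ) :
    ∫ ω, F (O (k + 1) ω) ω ∂μ = ∫ ω, ∑ s, P (O k ω) s * F s ω ∂μ := by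
  classical
  have hmeas : ∀ s, MeasurableSet (O (k + 1) ⁻¹' {s}) := fun s =>
    hO.measurable (k + 1) (measurableSet_singleton s)
  -- Splitting by the value of the next state leaves `ℱ k`-measurable factors, which can be pulled
  -- out of the conditional expectation.
  have hdecomp : ∀ ω, F (O (k + 1) ω) ω =
      ∑ s, (F s * (O (k + 1) ⁻¹' {s}).indicator fun _ => (1 : ℝ)) ω := by
    intro ω
    simp [Set.indicator_apply]
  have hint1 : ∀ s, Integrable (F s * (O (k + 1) ⁻¹' {s}).indicator fun _ => (1 : ℝ)) μ := by
    intro s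
    have : (F s * (O (k + 1) ⁻¹' {s}).indicator fun _ => (1 : ℝ))
        = (O (k + 1) ⁻¹' {s}).indicator (F s) := by
      ext ω
      simp [Set.indicator_apply]
    rw [this]
    exact (hint s).indicator (hmeas s)
  have hcond : ∀ s, μ[F s * (O (k + 1) ⁻¹' {s}).indicator fun _ => (1 : ℝ) | ℱ k]
      =ᵐ[μ] fun ω => P (O k ω) s * F s ω := by
    intro s
    have h1 := condExp_mul_of_stronglyMeasurable_left (hF s).stronglyMeasurable (hint1 s)
      ((integrable_const (1 : ℝ)).indicator (hmeas s))
    filter_upwards [h1, hO.2 k s] with ω h2 h3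
    rw [h2, Pi.mul_apply, h3, mul_comm]
  have hint2 : ∀ s, Integrable (fun ω => P (O k ω) s * F s ω) μ := fun s =>
    (integrable_congr (hcond s)).1 integrable_condExp
  simp only [hdecomp]
  rw [integral_finsetSum _ fun s _ => hint1 s, integral_finsetSum _ fun s _ => hint2 s]
  refine Finset.sum_congr rfl fun s _ => ?_
  rw [← integral_condExp (ℱ.le k), integral_congr_ae (hcond s)]

end Markov

/-! ### Measurability and integrability of functions of the iterates. -/

section Integrability

variable {S Ω E : Type*} [Fintype S] [MeasurableSpace S] [MeasurableSingletonClass S]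
  {mΩ : MeasurableSpace Ω} {μ : Measure Ω} [IsProbabilityMeasure μ]
  [NormedAddCommGroup E]

lemma integrable_one_add_norm_sq {X : Ω → E} (hX2 : MemLp X 2 μ) :
    Integrable (fun ω => (1 + ‖X ω‖) ^ 2) μ :=
  ((memLp_const (1 : ℝ)).add hX2.norm).integrable_sq

variable [MeasurableSpace E] [BorelSpace E]

lemma measurable_comp_of_continuous {F : Type*} [TopologicalSpace F] [MeasurableSpace F]
    [BorelSpace F] {m : MeasurableSpace Ω}
    {f : S → E → F} (hf : ∀ s, Continuous (f s)) {Y : Ω → S} {X : Ω → E}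
    (hY : Measurable Y) (hX : Measurable X) : Measurable fun ω => f (Y ω) (X ω) := by
  have h : Measurable (Function.uncurry f) :=
    measurable_from_prod_countable_right fun s => (hf s).measurable
  exact h.comp (hY.prodMk hX)

lemma integrable_of_quadratic_growth {f : S → E → ℝ} (hf : ∀ s, Continuous (f s)) {C : ℝ}
    (hC : ∀ s z, |f s z| ≤ C * (1 + ‖z‖) ^ 2) {Y : Ω → S} {X : Ω → E}
    (hY : Measurable Y) (hX : Measurable X) (hX2 : MemLp X 2 μ) :
    Integrable (fun ω => f (Y ω) (X ω)) μ := by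
  refine ((integrable_one_add_norm_sq hX2).const_mul C).mono'
    (measurable_comp_of_continuous hf hY hX).aestronglyMeasurable ?_
  exact Eventually.of_forall fun ω => hC _ _

end Integrability

end TwoTimeScale

namespace TwoTimeScale

/-! ### Growth and variation of the quadratic polynomials in the corrector. -/

section AffineForm

variable {E : Type*} [NormedAddCommGroup E] [NormedSpace ℝ E]

/-- The quadratic polynomial `z ↦ Q(z, A z + v)`. -/
noncomputable def affineForm (Q : E →L[ℝ] E →L[ℝ] ℝ) (A : E →L[ℝ] E) (v : E) (z : E) : ℝ := Q z (A z + v)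

variable {Q : E →L[ℝ] E →L[ℝ] ℝ} {A : E →L[ℝ] E} {v : E} {R : ℝ}

lemma continuous_affineForm : Continuous (affineForm Q A v) := by
  unfold affineForm
  fun_prop

lemma norm_apply_add_le (hR : ‖A‖ + ‖v‖ ≤ R) (z : E) : ‖A z + v‖ ≤ R * (1 + ‖z‖) := by
  have h1 := norm_add_le (A z) v
  have h2 := A.le_opNorm z
  have h3 := mul_le_mul_of_nonneg_right hR (norm_nonneg z)
  have h4 := mul_nonneg (norm_nonneg v) (norm_nonneg z)
  have h5 := norm_nonneg A
  linarith

lemma abs_bilin_le (x y : E) : |Q x y| ≤ ‖Q‖ * ‖x‖ * ‖y‖ := Q.le_opNorm₂ x y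

lemma abs_affineForm_le (hR : ‖A‖ + ‖v‖ ≤ R) (z : E) :
    |affineForm Q A v z| ≤ ‖Q‖ * R * (1 + ‖z‖) ^ 2 := by
  have hR0 : 0 ≤ R := le_trans (by positivity) hR
  calc |affineForm Q A v z| ≤ ‖Q‖ * ‖z‖ * ‖A z + v‖ := abs_bilin_le _ _
    _ ≤ ‖Q‖ * (1 + ‖z‖) * (R * (1 + ‖z‖)) := by
        gcongr
        · linarith
        · exact norm_apply_add_le hR z
    _ = _ := by ring

lemma abs_affineForm_add_sub_le (hR : ‖A‖ + ‖v‖ ≤ R) (z d : E) :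
    |affineForm Q A v (z + d) - affineForm Q A v z| ≤
      ‖Q‖ * R * ‖d‖ * (2 * (1 + ‖z‖) + ‖d‖) := by
  have hR0 : 0 ≤ R := le_trans (by positivity) hR
  have hA : ‖A d‖ ≤ R * ‖d‖ :=
    (A.le_opNorm d).trans (mul_le_mul_of_nonneg_right (by linarith [norm_nonneg v]) (norm_nonneg d))
  have h : affineForm Q A v (z + d) - affineForm Q A v z
      = Q d (A z + v) + Q z (A d) + Q d (A d) := by
    simp only [affineForm, map_add, add_apply]
    ring
  rw [h]
  have h1 : |Q d (A z + v)| ≤ ‖Q‖ * ‖d‖ * (R * (1 + ‖z‖)) :=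
    (abs_bilin_le _ _).trans (by gcongr; exact norm_apply_add_le hR z)
  have h2 : |Q z (A d)| ≤ ‖Q‖ * (1 + ‖z‖) * (R * ‖d‖) :=
    (abs_bilin_le _ _).trans (by gcongr; linarith)
  have h3 : |Q d (A d)| ≤ ‖Q‖ * ‖d‖ * (R * ‖d‖) := (abs_bilin_le _ _).trans (by gcongr)
  have h4 := abs_add_le (Q d (A z + v) + Q z (A d)) (Q d (A d))
  have h5 := abs_add_le (Q d (A z + v)) (Q z (A d))
  linarith

/-- The change of a slowly varying multiple of `affineForm` along a small increment. -/
lemma abs_mul_affineForm_sub_le (hR : ‖A‖ + ‖v‖ ≤ R) {z d : E} {t t' a B D : ℝ} (ha : 0 ≤ a)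
    (haD : a ≤ D) (ht0 : 0 ≤ t) (ht : t ≤ D * a) (htt : |t' - t| ≤ D * a ^ 2) (hB : 0 ≤ B)
    (hd : ‖d‖ ≤ B * a * (1 + ‖z‖)) :
    |t' * affineForm Q A v (z + d) - t * affineForm Q A v z| ≤
      ‖Q‖ * R * D * ((1 + B * D) ^ 2 + B * (2 + B * D)) * a ^ 2 * (1 + ‖z‖) ^ 2 := by
  have hR0 : 0 ≤ R := le_trans (by positivity) hR
  have hD0 : 0 ≤ D := ha.trans haD
  have hd' : ‖d‖ ≤ B * D * (1 + ‖z‖) := hd.trans (by gcongr)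
  have e1 : |affineForm Q A v (z + d)| ≤ ‖Q‖ * R * ((1 + B * D) * (1 + ‖z‖)) ^ 2 := by
    refine (abs_affineForm_le hR _).trans ?_
    gcongr
    have := norm_add_le z d
    linarith
  have e2 : |affineForm Q A v (z + d) - affineForm Q A v z| ≤
      ‖Q‖ * R * (B * a * (1 + ‖z‖)) * (2 * (1 + ‖z‖) + B * D * (1 + ‖z‖)) := by
    refine (abs_affineForm_add_sub_le hR _ _).trans ?_
    gcongr
  -- Both pieces are of order `a²`: the coefficient moves by `O(a²)`, and the polynomial moves by
  -- `O(a)` under a coefficient that is itself `O(a)`.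
  have e3 : t' * affineForm Q A v (z + d) - t * affineForm Q A v z =
      (t' - t) * affineForm Q A v (z + d) +
        t * (affineForm Q A v (z + d) - affineForm Q A v z) := by ring
  have f1 : |(t' - t) * affineForm Q A v (z + d)| ≤
      D * a ^ 2 * (‖Q‖ * R * ((1 + B * D) * (1 + ‖z‖)) ^ 2) := by
    rw [abs_mul]
    gcongr
  have f2 : |t * (affineForm Q A v (z + d) - affineForm Q A v z)| ≤
      D * a * (‖Q‖ * R * (B * a * (1 + ‖z‖)) * (2 * (1 + ‖z‖) + B * D * (1 + ‖z‖))) := by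
    rw [abs_mul, abs_of_nonneg ht0]
    gcongr
  rw [e3]
  refine (abs_add_le _ _).trans ((add_le_add f1 f2).trans (le_of_eq ?_))
  ring

/-- Solutions of the Poisson equation for the coefficients yield one for the quadratic
polynomials. -/
lemma bilin_eq_add_affineForm_sub {S : Type*} [Fintype S] {P : Matrix S S ℝ} {s : S}
    {A' : E →L[ℝ] E} {K : S → E →L[ℝ] E} {κ : S → E}
    (hK : K s - ∑ u, P s u • K u = A - A') (hκ : κ s - ∑ u, P s u • κ u = v) (z : E) :
    Q z (A z + v) = Q z (A' z) +
      (affineForm Q (K s) (κ s) z - ∑ u, P s u * affineForm Q (K u) (κ u) z) := by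
  have h1 : A z = A' z + (K s z - ∑ u, P s u • K u z) := by
    have := congrArg (fun T : E →L[ℝ] E => T z) hK
    simp only [sub_apply, sum_apply, smul_apply] at this
    rw [this]
    abel
  simp only [affineForm, h1, ← hκ, map_add, map_sub, map_sum, map_smul, smul_eq_mul, mul_add,
    Finset.sum_add_distrib]
  ring

end AffineForm

/-- Step sizes `a` (fast) and `b` (slow) of two-time-scale stochastic approximation. -/
structure IsTwoTimeScaleSteps (a b : ℕ → ℝ) (D : ℝ) : Prop where
  fast_pos : ∀ k, 0 < a k
  slow_pos : ∀ k, 0 < b k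
  tendsto_fast : Tendsto a atTop (𝓝 0)
  tendsto_slow : Tendsto b atTop (𝓝 0)
  tendsto_slow_div_fast : Tendsto (fun k => b k / a k) atTop (𝓝 0)
  tendsto_sq_fast_div_slow : Tendsto (fun k => a k ^ 2 / b k) atTop (𝓝 0)
  tendsto_sum_slow : Tendsto (fun n => ∑ k ∈ Finset.range n, b k) atTop atTop
  one_le : 1 ≤ D
  fast_le : ∀ k, a k ≤ D
  slow_le : ∀ k, b k ≤ D * a k
  abs_fast_sub_le : ∀ k, |a (k + 1) - a k| ≤ D * a k ^ 2
  abs_slow_sub_le : ∀ k, |b (k + 1) - b k| ≤ D * a k ^ 2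

/-! ### Corrected Lyapunov descent along the Markov-driven recursion. -/

section LinearRecursion

variable {S E : Type*} [NormedAddCommGroup E] [NormedSpace ℝ E]

/-- The Poisson correction of the Lyapunov function. -/
noncomputable def corrector (Q : E →L[ℝ] E →L[ℝ] ℝ) (K K' : S → E →L[ℝ] E) (κ κ' : S → E) (a b : ℕ → ℝ)
    (k : ℕ) (s : S) (z : E) : ℝ :=
  2 * (a k * affineForm Q (K s) (κ s) z) + 2 * (b k * affineForm Q (K' s) (κ' s) z)

variable {Q : E →L[ℝ] E →L[ℝ] ℝ} {M M' K K' : S → E →L[ℝ] E} {m m' κ κ' : S → E}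
  {Mbar Mbar' : E →L[ℝ] E} {a b : ℕ → ℝ} {D R : ℝ} {P : Matrix S S ℝ}

/-- The factor `a k` makes the correction asymptotically negligible against `Q z z`, up to an
additive error tending to zero. -/
lemma abs_corrector_le (hab : IsTwoTimeScaleSteps a b D) (hK : ∀ s, ‖K s‖ + ‖κ s‖ ≤ R)
    (hK' : ∀ s, ‖K' s‖ + ‖κ' s‖ ≤ R) (k : ℕ) (s : S) (z : E) :
    |corrector Q K K' κ κ' a b k s z| ≤ 4 * D * (‖Q‖ * R) * a k * (1 + ‖z‖) ^ 2 := by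
  have ha := (hab.fast_pos k).le
  have hb := (hab.slow_pos k).le
  have hR0 : 0 ≤ R := le_trans (by positivity) (hK s)
  have hD := hab.one_le
  have e1 : |a k * affineForm Q (K s) (κ s) z| ≤ D * a k * (‖Q‖ * R * (1 + ‖z‖) ^ 2) := by
    rw [abs_mul, abs_of_nonneg ha]
    gcongr
    · nlinarith
    · exact abs_affineForm_le (hK s) z
  have e2 : |b k * affineForm Q (K' s) (κ' s) z| ≤ D * a k * (‖Q‖ * R * (1 + ‖z‖) ^ 2) := by
    rw [abs_mul, abs_of_nonneg hb]
    gcongr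
    · exact hab.slow_le k
    · exact abs_affineForm_le (hK' s) z
  unfold corrector
  rw [abs_le] at e1 e2 ⊢
  constructor <;> linarith [e1.1, e1.2, e2.1, e2.2]

lemma continuous_corrector (k : ℕ) (s : S) : Continuous (corrector Q K K' κ κ' a b k s) := by
  unfold corrector
  exact ((continuous_affineForm.const_mul _).const_mul _).add
    ((continuous_affineForm.const_mul _).const_mul _)

variable [Fintype S]

/-- The pathwise descent inequality for the corrected Lyapunov function. -/
lemma exists_corrected_descent (hab : IsTwoTimeScaleSteps a b D) (hQ : ∀ v w, Q v w = Q w v)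
    (hM : ∀ s, ‖M s‖ + ‖m s‖ ≤ R) (hM' : ∀ s, ‖M' s‖ + ‖m' s‖ ≤ R)
    (hKR : ∀ s, ‖K s‖ + ‖κ s‖ ≤ R) (hKR' : ∀ s, ‖K' s‖ + ‖κ' s‖ ≤ R) (hR : 0 ≤ R)
    (hK : ∀ s, K s - ∑ u, P s u • K u = M s - Mbar) (hκ : ∀ s, κ s - ∑ u, P s u • κ u = m s)
    (hK' : ∀ s, K' s - ∑ u, P s u • K' u = M' s - Mbar')
    (hκ' : ∀ s, κ' s - ∑ u, P s u • κ' u = m' s) :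
    ∃ C : ℝ, 0 ≤ C ∧ ∀ (k : ℕ) (s s' : S) (z z' : E),
      z' = z + a k • (M s z + m s) + b k • (M' s z + m' s) →
      Q z' z' + corrector Q K K' κ κ' a b (k + 1) s' z' ≤
        Q z z + corrector Q K K' κ κ' a b k s z
        + (corrector Q K K' κ κ' a b k s' z - ∑ u, P s u * corrector Q K K' κ κ' a b k u z)
        + 2 * (a k * Q z (Mbar z) + b k * Q z (Mbar' z)) + C * a k ^ 2 * (1 + ‖z‖) ^ 2 := by
  have hD1 := hab.one_le
  have hD0 : 0 ≤ D := by linarith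
  -- `B` bounds the increment relative to `a k * (1 + ‖z‖)`: `R` from the fast part and `R * D` from
  -- the slow one.
  set B := R * (1 + D) with hBdef
  have hB : 0 ≤ B := by positivity
  set G := ‖Q‖ * R * D * ((1 + B * D) ^ 2 + B * (2 + B * D)) with hG
  refine ⟨4 * G + ‖Q‖ * B ^ 2, by positivity, fun k s s' z z' hz' => ?_⟩
  have ha := (hab.fast_pos k).le
  have hb := (hab.slow_pos k).le
  set d := a k • (M s z + m s) + b k • (M' s z + m' s) with hd
  have hz : z' = z + d := by rw [hz', hd, add_assoc]
  have hdle : ‖d‖ ≤ B * a k * (1 + ‖z‖) := by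
    have e1 : ‖a k • (M s z + m s)‖ ≤ a k * (R * (1 + ‖z‖)) := by
      rw [norm_smul, Real.norm_of_nonneg ha]
      gcongr
      exact norm_apply_add_le (hM s) z
    have e2 : ‖b k • (M' s z + m' s)‖ ≤ D * a k * (R * (1 + ‖z‖)) := by
      rw [norm_smul, Real.norm_of_nonneg hb]
      gcongr
      · exact hab.slow_le k
      · exact norm_apply_add_le (hM' s) z
    have e3 := norm_add_le (a k • (M s z + m s)) (b k • (M' s z + m' s))
    rw [hBdef]
    linarith
  have hdd : Q d d ≤ ‖Q‖ * B ^ 2 * a k ^ 2 * (1 + ‖z‖) ^ 2 := by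
    calc Q d d ≤ ‖Q‖ * ‖d‖ * ‖d‖ := (le_abs_self _).trans (abs_bilin_le _ _)
      _ ≤ ‖Q‖ * (B * a k * (1 + ‖z‖)) * (B * a k * (1 + ‖z‖)) := by gcongr
      _ = _ := by ring
  -- By the Poisson equations, `2 * Q z d` is the averaged drift plus the corrector at `s` minus its
  -- `P`-average. The new corrector at `(s', z')` is replaced by the old one at `(s', z)` at cost
  -- `O(a²)`.
  have hexp : Q z' z' = Q z z + 2 * Q z d + Q d d := by
    rw [hz]
    simp only [map_add, add_apply, hQ d z]
    ring
  have hzd : Q z d = a k * Q z (M s z + m s) + b k * Q z (M' s z + m' s) := by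
    simp only [hd, map_add, map_smul, smul_eq_mul]
  have hp := bilin_eq_add_affineForm_sub (Q := Q) (hK s) (hκ s) z
  have hp' := bilin_eq_add_affineForm_sub (Q := Q) (hK' s) (hκ' s) z
  have hsum : ∑ u, P s u * corrector Q K K' κ κ' a b k u z =
      2 * (a k * ∑ u, P s u * affineForm Q (K u) (κ u) z) +
        2 * (b k * ∑ u, P s u * affineForm Q (K' u) (κ' u) z) := by
    simp only [corrector, Finset.mul_sum, ← Finset.sum_add_distrib]
    exact Finset.sum_congr rfl fun u _ => by ring
  have hc1 := abs_mul_affineForm_sub_le (Q := Q) (hKR s') ha (hab.fast_le k) ha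
    (by nlinarith) (hab.abs_fast_sub_le k) hB hdle
  have hc2 := abs_mul_affineForm_sub_le (Q := Q) (hKR' s') ha (hab.fast_le k) hb
    (hab.slow_le k) (hab.abs_slow_sub_le k) hB hdle
  rw [← hG, ← hz] at hc1 hc2
  have hc1' := (abs_le.1 hc1).2
  have hc2' := (abs_le.1 hc2).2
  rw [hexp, hzd, hp, hp', hsum]
  simp only [corrector]
  linarith

variable {Ω : Type*} [MeasurableSpace S] [MeasurableSingletonClass S]
  {mΩ : MeasurableSpace Ω} {μ : Measure Ω} [IsProbabilityMeasure μ]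
  [MeasurableSpace E] [BorelSpace E]

lemma measurable_linear_recursion {ℱ : Filtration ℕ mΩ} {O : ℕ → Ω → S}
    (hO : ∀ k, Measurable[ℱ k] (O k)) {w : ℕ → Ω → E} (hw0 : Measurable[ℱ 0] (w 0))
    (hw : ∀ k ω, w (k + 1) ω = w k ω + a k • (M (O k ω) (w k ω) + m (O k ω))
      + b k • (M' (O k ω) (w k ω) + m' (O k ω))) (k : ℕ) : Measurable[ℱ k] (w k) := by
  induction k with
  | zero => exact hw0
  | succ k ih =>
    -- The update uses only `O k` and `w k`, so `w (k + 1)` is already `ℱ k`-measurable.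
    refine Measurable.mono (?_ : Measurable[ℱ k] (w (k + 1))) (ℱ.mono k.le_succ) le_rfl
    rw [funext (hw k)]
    exact measurable_comp_of_continuous (m := ℱ k)
      (f := fun s z => z + a k • (M s z + m s) + b k • (M' s z + m' s))
      (fun s => by fun_prop) (hO k) ih

variable [SecondCountableTopology E]

lemma memLp_linear_recursion (hM : ∀ s, ‖M s‖ + ‖m s‖ ≤ R) (hM' : ∀ s, ‖M' s‖ + ‖m' s‖ ≤ R)
    {O : ℕ → Ω → S} (hO : ∀ k, Measurable (O k)) {w : ℕ → Ω → E} (hwm : ∀ k, Measurable (w k))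
    (hw2 : MemLp (w 0) 2 μ)
    (hw : ∀ k ω, w (k + 1) ω = w k ω + a k • (M (O k ω) (w k ω) + m (O k ω))
      + b k • (M' (O k ω) (w k ω) + m' (O k ω))) (k : ℕ) : MemLp (w k) 2 μ := by
  induction k with
  | zero => exact hw2
  | succ k ih =>
    have key : ∀ (A : S → E →L[ℝ] E) (v : S → E), (∀ s, ‖A s‖ + ‖v s‖ ≤ R) →
        MemLp (fun ω => A (O k ω) (w k ω) + v (O k ω)) 2 μ := by
      intro A v hA
      have h1 : MemLp (fun ω => (1 : ℝ) + ‖w k ω‖) 2 μ := (memLp_const (1 : ℝ)).add ih.norm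
      refine MemLp.of_le_mul (c := R) h1 (measurable_comp_of_continuous
        (f := fun s z => A s z + v s) (fun s => by fun_prop) (hO k)
        (hwm k)).aestronglyMeasurable (Eventually.of_forall fun ω => ?_)
      rw [Real.norm_of_nonneg (by positivity)]
      exact norm_apply_add_le (hA _) _
    rw [funext (hw k)]
    exact (ih.add ((key M m hM).const_smul (a k))).add ((key M' m' hM').const_smul (b k))

/-- Mean-square convergence of a linear two-time-scale recursion driven by a Markov chain, given a
quadratic Lyapunov function for the averaged recursion. -/
theorem tendsto_integral_norm_sq_of_drift [DecidableEq S]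
    (hP : P ∈ Matrix.rowStochastic ℝ S) (hirr : P.IsIrreducible) {π : S → ℝ} (hπ : IsStationary P π) {ℱ : Filtration ℕ mΩ}
    {O : ℕ → Ω → S} (hO : IsMarkovChain μ ℱ P O) (hab : IsTwoTimeScaleSteps a b D)
    (hQ : ∀ v w, Q v w = Q w v) {c : ℝ} (hc : 0 < c) (hQc : ∀ v, c * ‖v‖ ^ 2 ≤ Q v v)
    (hMbar : ∑ s, π s • M s = Mbar) (hMbar' : ∑ s, π s • M' s = Mbar')
    (hm : ∑ s, π s • m s = 0) (hm' : ∑ s, π s • m' s = 0)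
    (hdrift : ∀ᶠ k in atTop, ∀ z,
      a k * Q z (Mbar z) + b k * Q z (Mbar' z) ≤ -(c * b k * ‖z‖ ^ 2))
    {w : ℕ → Ω → E} (hw0 : Measurable[ℱ 0] (w 0)) (hw2 : MemLp (w 0) 2 μ)
    (hw : ∀ k ω, w (k + 1) ω = w k ω + a k • (M (O k ω) (w k ω) + m (O k ω))
      + b k • (M' (O k ω) (w k ω) + m' (O k ω))) :
    (∀ k, MemLp (w k) 2 μ) ∧ Tendsto (fun k => ∫ ω, ‖w k ω‖ ^ 2 ∂μ) atTop (𝓝 0) := by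
  have hcenter : ∀ {A : S → E →L[ℝ] E} {A' : E →L[ℝ] E}, ∑ s, π s • A s = A' →
      ∑ s, π s • (A s - A') = 0 := by
    intro A A' h
    simp only [smul_sub, Finset.sum_sub_distrib, ← Finset.sum_smul, hπ.1.2, h, one_smul, sub_self]
  obtain ⟨K, hK⟩ := exists_poisson hP hirr hπ _ (hcenter hMbar)
  obtain ⟨K', hK'⟩ := exists_poisson hP hirr hπ _ (hcenter hMbar')
  obtain ⟨κ, hκ⟩ := exists_poisson hP hirr hπ _ hm
  obtain ⟨κ', hκ'⟩ := exists_poisson hP hirr hπ _ hm'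
  obtain ⟨R, hR⟩ := (Set.finite_range fun s => ‖M s‖ + ‖m s‖ + (‖M' s‖ + ‖m' s‖) +
    (‖K s‖ + ‖κ s‖) + (‖K' s‖ + ‖κ' s‖)).bddAbove
  have hR' := fun s => hR ⟨s, rfl⟩
  simp only at hR'
  have hM : ∀ s, ‖M s‖ + ‖m s‖ ≤ R := fun s => le_trans (by
    have : 0 ≤ (‖M' s‖ + ‖m' s‖) + (‖K s‖ + ‖κ s‖) + (‖K' s‖ + ‖κ' s‖) := by positivity
    linarith) (hR' s)
  have hM' : ∀ s, ‖M' s‖ + ‖m' s‖ ≤ R := fun s => le_trans (by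
    have : 0 ≤ (‖M s‖ + ‖m s‖) + (‖K s‖ + ‖κ s‖) + (‖K' s‖ + ‖κ' s‖) := by positivity
    linarith) (hR' s)
  have hKR : ∀ s, ‖K s‖ + ‖κ s‖ ≤ R := fun s => le_trans (by
    have : 0 ≤ (‖M s‖ + ‖m s‖) + (‖M' s‖ + ‖m' s‖) + (‖K' s‖ + ‖κ' s‖) := by positivity
    linarith) (hR' s)
  have hKR' : ∀ s, ‖K' s‖ + ‖κ' s‖ ≤ R := fun s => le_trans (by
    have : 0 ≤ (‖M s‖ + ‖m s‖) + (‖M' s‖ + ‖m' s‖) + (‖K s‖ + ‖κ s‖) := by positivity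
    linarith) (hR' s)
  have hR0 : 0 ≤ R := by
    obtain ⟨ω⟩ := μ.nonempty_of_neZero
    exact le_trans (by positivity) (hM (O 0 ω))
  obtain ⟨C, hC0, hdesc⟩ := exists_corrected_descent hab hQ hM hM' hKR hKR' hR0 hK hκ hK' hκ'
  have hwF := measurable_linear_recursion hO.1 hw0 hw
  have hwm : ∀ k, Measurable (w k) := fun k => (hwF k).mono (ℱ.le k) le_rfl
  have hwL := memLp_linear_recursion hM hM' hO.measurable hwm hw2 hw
  refine ⟨hwL, ?_⟩
  set Φ := corrector Q K K' κ κ' a b with hΦ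
  set n : ℕ → ℝ := fun k => ∫ ω, ‖w k ω‖ ^ 2 ∂μ with hn
  have hΦle : ∀ k s z, |Φ k s z| ≤ 4 * D * (‖Q‖ * R) * a k * (1 + ‖z‖) ^ 2 := fun k s z =>
    abs_corrector_le hab hKR hKR' k s z
  have hint : ∀ j k, Integrable (fun ω => Φ k (O j ω) (w k ω)) μ := fun j k =>
    integrable_of_quadratic_growth (continuous_corrector k) (hΦle k) (hO.measurable j) (hwm k)
      (hwL k)
  have hints : ∀ s k, Integrable (fun ω => Φ k s (w k ω)) μ := fun s k =>
    integrable_of_quadratic_growth (continuous_corrector k) (hΦle k) measurable_const (hwm k)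
      (hwL k)
  have hintP : ∀ k, Integrable (fun ω => ∑ u, P (O k ω) u * Φ k u (w k ω)) μ := by
    intro k
    refine integrable_finsetSum _ fun u _ => ?_
    refine (hints u k).bdd_mul (c := 1)
      ((measurable_of_countable fun s => P s u).comp (hO.measurable k)).aestronglyMeasurable
      (Eventually.of_forall fun ω => ?_)
    rw [Real.norm_of_nonneg (Matrix.nonneg_of_mem_rowStochastic hP)]
    exact Matrix.le_one_of_mem_rowStochastic hP
  have hintsq : ∀ k, Integrable (fun ω => (1 + ‖w k ω‖) ^ 2) μ := fun k =>
    integrable_one_add_norm_sq (hwL k)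
  have hintn : ∀ k, Integrable (fun ω => ‖w k ω‖ ^ 2) μ := fun k => (hwL k).norm.integrable_sq
  have hintQ : ∀ k, Integrable (fun ω => Q (w k ω) (w k ω)) μ := by
    intro k
    refine ((hintn k).const_mul ‖Q‖).mono' ?_ (Eventually.of_forall fun ω => ?_)
    · have : Continuous fun z => Q z z := by fun_prop
      exact (this.measurable.comp (hwm k)).aestronglyMeasurable
    · exact (abs_bilin_le _ _).trans (le_of_eq (by ring))
  have hsq : ∀ k, ∫ ω, (1 + ‖w k ω‖) ^ 2 ∂μ ≤ 2 * (1 + n k) := by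
    intro k
    have h1 : ∫ ω, 2 * (1 + ‖w k ω‖ ^ 2) ∂μ = 2 * (1 + n k) := by
      rw [integral_const_mul, integral_add (integrable_const _) (hintn k)]
      simp [hn]
    rw [← h1]
    refine integral_mono (hintsq k) (((integrable_const _).add (hintn k)).const_mul 2) fun ω => ?_
    nlinarith [sq_nonneg (1 - ‖w k ω‖)]
  have hΦint : ∀ k, |∫ ω, Φ k (O k ω) (w k ω) ∂μ| ≤
      8 * D * (‖Q‖ * R) * a k * (1 + n k) := by
    intro k
    have hak := (hab.fast_pos k).le
    have hD0 : 0 ≤ D := by linarith [hab.one_le]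
    calc |∫ ω, Φ k (O k ω) (w k ω) ∂μ| ≤ ∫ ω, |Φ k (O k ω) (w k ω)| ∂μ :=
          abs_integral_le_integral_abs
      _ ≤ ∫ ω, 4 * D * (‖Q‖ * R) * a k * (1 + ‖w k ω‖) ^ 2 ∂μ :=
          integral_mono (hint k k).abs ((hintsq k).const_mul _) fun ω => hΦle _ _ _
      _ = 4 * D * (‖Q‖ * R) * a k * ∫ ω, (1 + ‖w k ω‖) ^ 2 ∂μ := integral_const_mul _ _
      _ ≤ 4 * D * (‖Q‖ * R) * a k * (2 * (1 + n k)) := by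
          gcongr
          exact hsq k
      _ = _ := by ring
  -- The bracketed noise term of the descent inequality has mean zero: `w k` is known at time `k`,
  -- and only the next state is averaged.
  have hmarkov : ∀ k, ∫ ω, Φ k (O (k + 1) ω) (w k ω) ∂μ =
      ∫ ω, ∑ u, P (O k ω) u * Φ k u (w k ω) ∂μ := by
    intro k
    refine hO.integral_succ k (F := fun s ω => Φ k s (w k ω)) (fun s => ?_) fun s => hints s k
    exact (continuous_corrector k s).measurable.comp (hwF k)
  set u : ℕ → ℝ := fun k => ∫ ω, (Q (w k ω) (w k ω) + Φ k (O k ω) (w k ω)) ∂μ with hu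
  have hu' : ∀ k, u k = ∫ ω, Q (w k ω) (w k ω) ∂μ + ∫ ω, Φ k (O k ω) (w k ω) ∂μ := fun k =>
    integral_add (hintQ k) (hint k k)
  have hQlow : ∀ k, c * n k ≤ ∫ ω, Q (w k ω) (w k ω) ∂μ := by
    intro k
    rw [hn, ← integral_const_mul]
    exact integral_mono ((hintn k).const_mul c) (hintQ k) fun ω => hQc _
  have hQupp : ∀ k, ∫ ω, Q (w k ω) (w k ω) ∂μ ≤ ‖Q‖ * n k := by
    intro k
    rw [hn, ← integral_const_mul]
    exact integral_mono (hintQ k) ((hintn k).const_mul ‖Q‖) fun ω =>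
      (le_abs_self _).trans ((abs_bilin_le _ _).trans (le_of_eq (by ring)))
  have hn0 : ∀ k, 0 ≤ n k := fun k => integral_nonneg fun ω => by positivity
  have hrec : ∀ᶠ k in atTop, u (k + 1) ≤ u k - 2 * c * b k * n k + 2 * C * a k ^ 2 * (1 + n k) := by
    filter_upwards [hdrift] with k hk
    have i1 : Integrable (fun ω => Q (w k ω) (w k ω) + Φ k (O k ω) (w k ω)) μ :=
      (hintQ k).add (hint k k)
    have i2 : Integrable (fun ω => Φ k (O (k + 1) ω) (w k ω) -
        ∑ u, P (O k ω) u * Φ k u (w k ω)) μ := (hint (k + 1) k).sub (hintP k)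
    have i3 : Integrable (fun ω => Q (w k ω) (w k ω) + Φ k (O k ω) (w k ω) +
        (Φ k (O (k + 1) ω) (w k ω) - ∑ u, P (O k ω) u * Φ k u (w k ω))) μ := i1.add i2
    have i4 : Integrable (fun ω => Q (w k ω) (w k ω) + Φ k (O k ω) (w k ω) +
        (Φ k (O (k + 1) ω) (w k ω) - ∑ u, P (O k ω) u * Φ k u (w k ω)) +
        (-(2 * c * b k)) * ‖w k ω‖ ^ 2) μ := i3.add ((hintn k).const_mul _)
    have h1 : u (k + 1) ≤ ∫ ω, (Q (w k ω) (w k ω) + Φ k (O k ω) (w k ω) +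
        (Φ k (O (k + 1) ω) (w k ω) - ∑ u, P (O k ω) u * Φ k u (w k ω)) +
        (-(2 * c * b k)) * ‖w k ω‖ ^ 2 + C * a k ^ 2 * (1 + ‖w k ω‖) ^ 2) ∂μ := by
      refine integral_mono ((hintQ _).add (hint _ _)) (i4.add ((hintsq k).const_mul _)) fun ω => ?_
      have := hdesc k (O k ω) (O (k + 1) ω) (w k ω) (w (k + 1) ω) (hw k ω)
      have h2 := hk (w k ω)
      linarith
    rw [integral_add i4 ((hintsq k).const_mul _), integral_add i3 ((hintn k).const_mul _),
      integral_add i1 i2, integral_sub (hint (k + 1) k) (hintP k), hmarkov k, sub_self,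
      integral_const_mul, integral_const_mul] at h1
    have h3 := mul_le_mul_of_nonneg_left (hsq k) (mul_nonneg hC0 (sq_nonneg (a k)))
    simp only [hu, hn] at h1 h3 ⊢
    linarith
  have hD0 : 0 ≤ D := by linarith [hab.one_le]
  set C' := 8 * D * (‖Q‖ * R) + ‖Q‖ + 2 * C + D with hC'
  have hC'D : D ≤ C' := by
    have : 0 ≤ 8 * D * (‖Q‖ * R) + ‖Q‖ + 2 * C := by positivity
    linarith
  have hC'Q : ‖Q‖ ≤ C' := by
    have : 0 ≤ 8 * D * (‖Q‖ * R) + 2 * C + D := by positivity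
    linarith
  have hC'C : 2 * C ≤ C' := by
    have : 0 ≤ 8 * D * (‖Q‖ * R) + ‖Q‖ + D := by positivity
    linarith
  have hC'1 : 8 * D * (‖Q‖ * R) ≤ C' := by
    have : 0 ≤ ‖Q‖ + 2 * C + D := by positivity
    linarith
  have hΦ' : ∀ k, |∫ ω, Φ k (O k ω) (w k ω) ∂μ| ≤ C' * a k * (1 + n k) := fun k =>
    (hΦint k).trans (by
      have := hn0 k
      have := (hab.fast_pos k).le
      gcongr)
  refine tendsto_zero_of_perturbed_lyapunov (u := u) (a := a) (b := b) (C := C') hc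
    (by linarith [hab.one_le]) hn0 hab.slow_pos hab.tendsto_fast hab.tendsto_slow
    hab.tendsto_sq_fast_div_slow hab.tendsto_sum_slow (fun k => ?_) (fun k => ?_) (fun k => ?_) ?_
  · exact (le_abs_self _).trans ((hab.abs_fast_sub_le k).trans (by gcongr))
  · rw [hu']
    linarith [hQlow k, (abs_le.1 (hΦ' k)).1]
  · rw [hu']
    linarith [hQupp k, (abs_le.1 (hΦ' k)).2, mul_le_mul_of_nonneg_right hC'Q (hn0 k)]
  · filter_upwards [hrec] with k hk
    -- Half of the drift `2 * c` is given up, so that one constant `c` serves for both coercivity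
    -- and descent.
    have h1 : 0 ≤ c * b k * n k :=
      mul_nonneg (mul_nonneg hc.le (hab.slow_pos k).le) (hn0 k)
    have h2 : 2 * C * a k ^ 2 * (1 + n k) ≤ C' * a k ^ 2 * (1 + n k) := by
      have := hn0 k
      gcongr
    linarith

end LinearRecursion

end TwoTimeScale

namespace TwoTimeScale

/-! ### A Lyapunov function for the coupled fast and slow system. -/

section BlockLyapunov

variable {X Y : Type*} [NormedAddCommGroup X] [NormedSpace ℝ X] [NormedAddCommGroup Y]
  [NormedSpace ℝ Y]

/-- The linear part `(x, y) ↦ (-(T₂₁ y + T₂₂ x), 0)` of the fast update. -/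
noncomputable def fastPart (T₂₁ : Y →L[ℝ] X) (T₂₂ : X →L[ℝ] X) : X × Y →L[ℝ] X × Y :=
  (-(T₂₁.comp (ContinuousLinearMap.snd ℝ X Y) + T₂₂.comp (ContinuousLinearMap.fst ℝ X Y))).prod 0

/-- The linear part `(x, y) ↦ (0, -(T₁₁ y + T₁₂ x))` of the slow update. -/
noncomputable def slowPart (T₁₁ : Y →L[ℝ] Y) (T₁₂ : X →L[ℝ] Y) : X × Y →L[ℝ] X × Y :=
  (0 : X × Y →L[ℝ] X).prod
    (-(T₁₁.comp (ContinuousLinearMap.snd ℝ X Y) + T₁₂.comp (ContinuousLinearMap.fst ℝ X Y)))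

@[simp] lemma fastPart_apply (T₂₁ : Y →L[ℝ] X) (T₂₂ : X →L[ℝ] X) (z : X × Y) :
    fastPart T₂₁ T₂₂ z = (-(T₂₁ z.2 + T₂₂ z.1), 0) := rfl

@[simp] lemma slowPart_apply (T₁₁ : Y →L[ℝ] Y) (T₁₂ : X →L[ℝ] Y) (z : X × Y) :
    slowPart T₁₁ T₁₂ z = (0, -(T₁₁ z.2 + T₁₂ z.1)) := rfl

/-- Lyapunov functions of the fast and of the reduced slow system yield one for the coupled
system. -/
lemma exists_block_lyapunov {T₁₁ : Y →L[ℝ] Y} {T₁₂ : X →L[ℝ] Y} {T₂₁ : Y →L[ℝ] X}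
    {T₂₂ : X →L[ℝ] X} {Γ : Y →L[ℝ] X} (hΓ : ∀ y, T₂₂ (Γ y) = T₂₁ y)
    {Q₂ : X →L[ℝ] X →L[ℝ] ℝ} {Q₁ : Y →L[ℝ] Y →L[ℝ] ℝ}
    (hQ₂s : ∀ v w, Q₂ v w = Q₂ w v) (hQ₁s : ∀ v w, Q₁ v w = Q₁ w v)
    (hQ₂p : ∀ v, ‖v‖ ^ 2 ≤ Q₂ v v) (hQ₁p : ∀ v, ‖v‖ ^ 2 ≤ Q₁ v v)
    {c₁ c₂ : ℝ} (hc₁ : 0 < c₁) (hc₂ : 0 < c₂) (hT₂₂ : ∀ v, c₂ * ‖v‖ ^ 2 ≤ Q₂ v (T₂₂ v))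
    (hΔ : ∀ v, c₁ * ‖v‖ ^ 2 ≤ Q₁ v (T₁₁ v - T₁₂ (Γ v)))
    {a b : ℕ → ℝ} (ha : ∀ k, 0 < a k) (hb : ∀ k, 0 < b k)
    (hab : Tendsto (fun k => b k / a k) atTop (𝓝 0)) :
    ∃ (Q : X × Y →L[ℝ] X × Y →L[ℝ] ℝ) (c : ℝ), 0 < c ∧ (∀ v w, Q v w = Q w v) ∧
      (∀ v, c * ‖v‖ ^ 2 ≤ Q v v) ∧ ∀ᶠ k in atTop, ∀ z,
        a k * Q z (fastPart T₂₁ T₂₂ z) + b k * Q z (slowPart T₁₁ T₁₂ z) ≤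
          -(c * b k * ‖z‖ ^ 2) := by
  -- For frozen `y` the fast equation has equilibrium `x = -Γ y`, and `p` is the deviation from it.
  let p : X × Y →L[ℝ] X := ContinuousLinearMap.fst ℝ X Y + Γ.comp (ContinuousLinearMap.snd ℝ X Y)
  let q : X × Y →L[ℝ] Y := ContinuousLinearMap.snd ℝ X Y
  have hp : ∀ z, p z = z.1 + Γ z.2 := fun z => rfl
  have hq : ∀ z, q z = z.2 := fun z => rfl
  let Q : X × Y →L[ℝ] X × Y →L[ℝ] ℝ := Q₂.bilinearComp p p + Q₁.bilinearComp q q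
  have hQ : ∀ v w, Q v w = Q₂ (p v) (p w) + Q₁ (q v) (q w) := fun v w => rfl
  set G := 1 + ‖Γ‖ with hG
  have hG1 : 1 ≤ G := by rw [hG]; linarith [norm_nonneg Γ]
  have hnorm : ∀ z, ‖z‖ ^ 2 ≤ 2 * G ^ 2 * (‖p z‖ ^ 2 + ‖q z‖ ^ 2) := by
    intro z
    have h1 : ‖z.1‖ ≤ ‖p z‖ + ‖Γ‖ * ‖q z‖ := by
      have e : z.1 = p z - Γ z.2 := by rw [hp]; abel
      rw [e]
      exact (norm_sub_le _ _).trans (by gcongr; exact Γ.le_opNorm _)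
    have h2 : ‖z‖ ≤ G * (‖p z‖ + ‖q z‖) := by
      rw [Prod.norm_def, max_le_iff]
      have h3 := mul_nonneg (norm_nonneg Γ) (norm_nonneg (p z))
      have h4 := mul_nonneg (norm_nonneg Γ) (norm_nonneg (q z))
      rw [← hq z]
      constructor
      · rw [hG]; linarith [norm_nonneg (q z)]
      · rw [hG]; linarith [norm_nonneg (p z)]
    calc ‖z‖ ^ 2 ≤ (G * (‖p z‖ + ‖q z‖)) ^ 2 := by gcongr
      _ = G ^ 2 * (‖p z‖ + ‖q z‖) ^ 2 := by ring
      _ ≤ G ^ 2 * (2 * (‖p z‖ ^ 2 + ‖q z‖ ^ 2)) := by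
          gcongr
          nlinarith [sq_nonneg (‖p z‖ - ‖q z‖)]
      _ = _ := by ring
  let U : Y →L[ℝ] Y := T₁₁ - T₁₂.comp Γ
  have hU : ∀ y, U y = T₁₁ y - T₁₂ (Γ y) := fun y => rfl
  set F := ‖Q₂‖ * ‖Γ‖ * (‖U‖ + ‖T₁₂‖) + ‖Q₁‖ * ‖T₁₂‖ with hF
  have hF0 : 0 ≤ F := by positivity
  have hslow : ∀ z, Q z (slowPart T₁₁ T₁₂ z) ≤
      -(c₁ / 2 * ‖q z‖ ^ 2) + (F + F ^ 2 / (2 * c₁)) * ‖p z‖ ^ 2 := by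
    intro z
    have e1 : T₁₁ z.2 + T₁₂ z.1 = U (q z) + T₁₂ (p z) := by
      rw [hU, hp, hq, map_add]; abel
    have e2 : Q z (slowPart T₁₁ T₁₂ z) = -(Q₂ (p z) (Γ (U (q z) + T₁₂ (p z)))
        + Q₁ (q z) (T₁₂ (p z))) - Q₁ (q z) (U (q z)) := by
      rw [hQ, slowPart_apply, e1, hp (0, _), hq (0, _)]
      simp only [map_neg, map_add, zero_add]
      ring
    have e3 : |Q₂ (p z) (Γ (U (q z) + T₁₂ (p z)))| ≤
        ‖Q₂‖ * ‖p z‖ * (‖Γ‖ * (‖U‖ * ‖q z‖ + ‖T₁₂‖ * ‖p z‖)) := by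
      refine (abs_bilin_le _ _).trans ?_
      gcongr
      refine (Γ.le_opNorm _).trans ?_
      gcongr
      exact (norm_add_le _ _).trans (add_le_add (U.le_opNorm _) (T₁₂.le_opNorm _))
    have e4 : |Q₁ (q z) (T₁₂ (p z))| ≤ ‖Q₁‖ * ‖q z‖ * (‖T₁₂‖ * ‖p z‖) := by
      refine (abs_bilin_le _ _).trans ?_
      gcongr
      exact T₁₂.le_opNorm _
    have e5 := hΔ (q z)
    rw [← hU] at e5
    have e6 : ‖Q₂‖ * ‖p z‖ * (‖Γ‖ * (‖U‖ * ‖q z‖ + ‖T₁₂‖ * ‖p z‖)) +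
        ‖Q₁‖ * ‖q z‖ * (‖T₁₂‖ * ‖p z‖) ≤ F * ‖p z‖ ^ 2 + F * (‖p z‖ * ‖q z‖) := by
      have f1 : 0 ≤ (‖Q₂‖ * ‖Γ‖ * ‖U‖ + ‖Q₁‖ * ‖T₁₂‖) * ‖p z‖ ^ 2 := by positivity
      have f2 : 0 ≤ ‖Q₂‖ * ‖Γ‖ * ‖T₁₂‖ * (‖p z‖ * ‖q z‖) := by positivity
      rw [hF]
      linarith
    -- Weighted Young inequality, spending half of the slow decay rate `c₁` on the cross terms.
    have e7 : F * (‖p z‖ * ‖q z‖) ≤ c₁ / 2 * ‖q z‖ ^ 2 + F ^ 2 / (2 * c₁) * ‖p z‖ ^ 2 := by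
      have : c₁ / 2 * ‖q z‖ ^ 2 + F ^ 2 / (2 * c₁) * ‖p z‖ ^ 2 - F * (‖p z‖ * ‖q z‖)
          = (c₁ * ‖q z‖ - F * ‖p z‖) ^ 2 / (2 * c₁) := by
        field_simp
        ring
      have h0 : 0 ≤ (c₁ * ‖q z‖ - F * ‖p z‖) ^ 2 / (2 * c₁) := by positivity
      linarith
    rw [e2]
    linarith [(abs_le.1 e3).1, (abs_le.1 e4).1]
  have hfast : ∀ z, Q z (fastPart T₂₁ T₂₂ z) ≤ -(c₂ * ‖p z‖ ^ 2) := by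
    intro z
    have e1 : T₂₁ z.2 + T₂₂ z.1 = T₂₂ (p z) := by
      rw [hp, map_add, hΓ]; abel
    have e2 : Q z (fastPart T₂₁ T₂₂ z) = -Q₂ (p z) (T₂₂ (p z)) := by
      rw [hQ, fastPart_apply, e1, hp (_, 0), hq (_, 0)]
      simp
    rw [e2]
    linarith [hT₂₂ (p z)]
  have hmin : 0 < min 1 (c₁ / 2) := by positivity
  refine ⟨Q, min 1 (c₁ / 2) / (2 * G ^ 2), by positivity, fun v w => ?_, fun v => ?_, ?_⟩
  · rw [hQ, hQ, hQ₂s, hQ₁s]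
  · calc min 1 (c₁ / 2) / (2 * G ^ 2) * ‖v‖ ^ 2
        ≤ 1 / (2 * G ^ 2) * (2 * G ^ 2 * (‖p v‖ ^ 2 + ‖q v‖ ^ 2)) := by
          gcongr
          · exact min_le_left _ _
          · exact hnorm v
      _ = ‖p v‖ ^ 2 + ‖q v‖ ^ 2 := by field_simp
      _ ≤ Q v v := by rw [hQ]; exact add_le_add (hQ₂p _) (hQ₁p _)
  · have hpos : 0 < c₁ / 2 + (F + F ^ 2 / (2 * c₁)) := by positivity
    -- Time-scale separation: the fast decay `c₂ * a k` pays for the slow cross terms in `‖p z‖ ^ 2`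
    -- and still leaves `c₁ / 2 * b k`.
    have hev : ∀ᶠ k in atTop, (c₁ / 2 + (F + F ^ 2 / (2 * c₁))) * (b k / a k) < c₂ := by
      have := hab.const_mul (c₁ / 2 + (F + F ^ 2 / (2 * c₁)))
      rw [mul_zero] at this
      exact this.eventually_lt_const hc₂
    filter_upwards [hev] with k hk z
    rw [← mul_div_assoc, div_lt_iff₀ (ha k)] at hk
    have h1 := mul_le_mul_of_nonneg_left (hfast z) (ha k).le
    have h2 := mul_le_mul_of_nonneg_left (hslow z) (hb k).le
    have h3 := mul_le_mul_of_nonneg_right hk.le (sq_nonneg ‖p z‖)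
    have h4 : min 1 (c₁ / 2) / (2 * G ^ 2) * b k * ‖z‖ ^ 2 ≤
        c₁ / 2 * b k * (‖p z‖ ^ 2 + ‖q z‖ ^ 2) := by
      have hbk := (hb k).le
      calc min 1 (c₁ / 2) / (2 * G ^ 2) * b k * ‖z‖ ^ 2
          ≤ (c₁ / 2) / (2 * G ^ 2) * b k * (2 * G ^ 2 * (‖p z‖ ^ 2 + ‖q z‖ ^ 2)) := by
            gcongr
            · exact min_le_right _ _
            · exact hnorm z
        _ = _ := by field_simp
    linarith

end BlockLyapunov

/-! ### Asymptotics of the polynomial step sizes. -/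

section Steps

/-- The step sizes `α / (k + 1) ^ ξ` and `β / (k + 1)` with `1/2 < ξ < 1`. -/
lemma exists_isTwoTimeScaleSteps {α β ξ : ℝ} (hα : 0 < α) (hβ : 0 < β) (hξ : 1 / 2 < ξ)
    (hξ' : ξ < 1) {a b : ℕ → ℝ} (ha : ∀ k, a k = α / ((k : ℝ) + 1) ^ ξ)
    (hb : ∀ k, b k = β / ((k : ℝ) + 1)) : ∃ D, IsTwoTimeScaleSteps a b D := by
  have hk : ∀ k : ℕ, (0 : ℝ) < (k : ℝ) + 1 := fun k => by positivity
  have hk1 : ∀ k : ℕ, (1 : ℝ) ≤ (k : ℝ) + 1 := fun k => by simp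
  have hpos : ∀ k : ℕ, (0 : ℝ) < ((k : ℝ) + 1) ^ ξ := fun k => Real.rpow_pos_of_pos (hk k) _
  have hone : ∀ k : ℕ, (1 : ℝ) ≤ ((k : ℝ) + 1) ^ ξ := fun k =>
    Real.one_le_rpow (hk1 k) (by linarith)
  have hle : ∀ k : ℕ, ((k : ℝ) + 1) ^ ξ ≤ (k : ℝ) + 1 := fun k => by
    simpa using Real.rpow_le_rpow_of_exponent_le (hk1 k) hξ'.le
  have hlim : Tendsto (fun k : ℕ => (k : ℝ) + 1) atTop atTop :=
    tendsto_atTop_add_const_right _ _ tendsto_natCast_atTop_atTop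
  have hneg : ∀ r : ℝ, 0 < r → Tendsto (fun k : ℕ => ((k : ℝ) + 1) ^ (-r)) atTop (𝓝 0) :=
    fun r hr => (tendsto_rpow_neg_atTop hr).comp hlim
  have ha0 : ∀ k, 0 < a k := fun k => by rw [ha]; exact div_pos hα (hpos k)
  have hb0 : ∀ k, 0 < b k := fun k => by rw [hb]; exact div_pos hβ (hk k)
  -- One summand for each bound: `one_le`, `fast_le`, `slow_le`, `abs_fast_sub_le`,
  -- `abs_slow_sub_le`.
  set D := 1 + α + β / α + 1 / α + β / α ^ 2 with hD
  have hdiv : ∀ k : ℕ, β / ((k : ℝ) + 1) ^ 2 ≤ β / α ^ 2 * a k ^ 2 := by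
    intro k
    rw [ha, div_pow, div_mul_div_comm, mul_comm β, mul_div_mul_left _ _ (by positivity)]
    have := hpos k
    gcongr
    exact hle k
  refine ⟨D, ha0, hb0, ?_, ?_, ?_, ?_, ?_, ?_, fun k => ?_, fun k => ?_, fun k => ?_, fun k => ?_⟩
  · have := (hneg ξ (by linarith)).const_mul α
    rw [mul_zero] at this
    refine this.congr fun k => ?_
    rw [ha, Real.rpow_neg (hk k).le, div_eq_mul_inv]
  · have := (hneg 1 one_pos).const_mul β
    rw [mul_zero] at this
    refine this.congr fun k => ?_
    rw [hb, Real.rpow_neg (hk k).le, Real.rpow_one, div_eq_mul_inv]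
  · have := (hneg (1 - ξ) (by linarith)).const_mul (β / α)
    rw [mul_zero] at this
    refine this.congr fun k => ?_
    rw [ha, hb, neg_sub, Real.rpow_sub (hk k), Real.rpow_one]
    have := hpos k
    have := hk k
    field_simp
  -- Here `1 / 2 < ξ` is essential: the ratio is a multiple of `(k + 1) ^ (1 - 2 * ξ)`.
  · have := (hneg (2 * ξ - 1) (by linarith)).const_mul (α ^ 2 / β)
    rw [mul_zero] at this
    refine this.congr fun k => ?_
    rw [ha, hb, neg_sub, Real.rpow_sub (hk k), Real.rpow_one, mul_comm 2 ξ, Real.rpow_mul (hk k).le,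
      Real.rpow_two]
    have := hpos k
    have := hk k
    field_simp
  · have := Real.tendsto_sum_range_one_div_nat_succ_atTop.const_mul_atTop hβ
    refine this.congr fun n => ?_
    rw [Finset.mul_sum]
    exact Finset.sum_congr rfl fun k _ => by rw [hb, mul_one_div]
  · have : 0 ≤ α + β / α + 1 / α + β / α ^ 2 := by positivity
    linarith
  · have h1 : a k ≤ α := by
      rw [ha]
      exact div_le_self hα.le (hone k)
    have : 0 ≤ 1 + β / α + 1 / α + β / α ^ 2 := by positivity
    linarith
  · have h1 : b k ≤ β / α * a k := by
      have := hpos k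
      rw [ha, hb, div_mul_div_comm, mul_comm β, mul_div_mul_left _ _ hα.ne']
      gcongr
      exact hle k
    have h2 : 0 ≤ (1 + α + 1 / α + β / α ^ 2) * a k := by
      have := (ha0 k).le
      positivity
    linarith
  · have hmono : a (k + 1) ≤ a k := by
      rw [ha, ha]
      have := hpos k
      gcongr
      simp
    -- The ratio `a (k + 1) / a k` is the `ξ`-th power of a number in `(0, 1]`, hence at least that
    -- number since `ξ < 1`.
    have hratio : a k * (1 - 1 / ((k : ℝ) + 1)) ≤ a (k + 1) := by
      have h1 := hk k
      have h2 := hk (k + 1)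
      have h3 : 1 - 1 / ((k : ℝ) + 1) ≤ ((k : ℝ) + 1) / (((k + 1 : ℕ) : ℝ) + 1) := by
        push_cast
        rw [one_sub_div h1.ne', div_le_div_iff₀ h1 (by positivity)]
        nlinarith
      have h4 : ((k : ℝ) + 1) / (((k + 1 : ℕ) : ℝ) + 1) ≤
          (((k : ℝ) + 1) / (((k + 1 : ℕ) : ℝ) + 1)) ^ ξ := by
        have h5 : ((k : ℝ) + 1) / (((k + 1 : ℕ) : ℝ) + 1) ≤ 1 := by
          rw [div_le_one h2]
          push_cast
          linarith
        simpa using Real.rpow_le_rpow_of_exponent_ge (div_pos h1 h2) h5 hξ'.le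
      have h6 : a (k + 1) = a k * (((k : ℝ) + 1) / (((k + 1 : ℕ) : ℝ) + 1)) ^ ξ := by
        rw [Real.div_rpow h1.le h2.le, ha, ha]
        have := hpos k
        have := hpos (k + 1)
        field_simp
      rw [h6]
      exact mul_le_mul_of_nonneg_left (h3.trans h4) (ha0 k).le
    have hinv : 1 / ((k : ℝ) + 1) ≤ 1 / α * a k := by
      have := hpos k
      rw [ha, one_div_mul_eq_div, div_div, mul_comm, ← div_div, div_self hα.ne']
      gcongr
      exact hle k
    have h1 : a k - a (k + 1) ≤ 1 / α * a k ^ 2 := by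
      have := mul_le_mul_of_nonneg_left hinv (ha0 k).le
      linarith
    have h2 : 0 ≤ (1 + α + β / α + β / α ^ 2) * a k ^ 2 := by positivity
    rw [abs_sub_comm, abs_of_nonneg (by linarith)]
    linarith
  · have h1 := hk k
    have hdiff : b k - b (k + 1) = β / (((k : ℝ) + 1) * ((k : ℝ) + 1 + 1)) := by
      rw [hb, hb]
      push_cast
      field_simp
      ring
    have h2 : b k - b (k + 1) ≤ β / ((k : ℝ) + 1) ^ 2 := by
      rw [hdiff, sq]
      gcongr
      linarith
    have h3 : 0 ≤ b k - b (k + 1) := by rw [hdiff]; positivity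
    have h4 : 0 ≤ (1 + α + β / α + 1 / α) * a k ^ 2 := by positivity
    rw [abs_sub_comm, abs_of_nonneg h3]
    linarith [hdiv k]

end Steps

end TwoTimeScale

namespace TwoTimeScale

/-! ### The averaged equations and the centered recursion. -/

section MeanSystem

variable {dx dy : ℕ}

lemma toEuclideanLin_mul_apply {l m n : ℕ} (A : Matrix (Fin l) (Fin m) ℝ)
    (B : Matrix (Fin m) (Fin n) ℝ) (v : EuclideanSpace ℝ (Fin n)) :
    (A * B).toEuclideanLin v = A.toEuclideanLin (B.toEuclideanLin v) := by
  rw [Matrix.toEuclideanLin, Matrix.toLpLin_mul_same]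
  rfl

lemma toEuclideanLin_one_apply {n : ℕ} (v : EuclideanSpace ℝ (Fin n)) :
    (1 : Matrix (Fin n) (Fin n) ℝ).toEuclideanLin v = v := by
  rw [Matrix.toEuclideanLin, Matrix.toLpLin_one]
  rfl

lemma sum_smul_toEuclideanLin {S : Type*} [Fintype S] {m n : ℕ} (π : S → ℝ)
    (A : S → Matrix (Fin m) (Fin n) ℝ) (v : EuclideanSpace ℝ (Fin n)) :
    ∑ s, π s • (A s).toEuclideanLin v = (∑ s, π s • A s).toEuclideanLin v := by
  simp [map_sum, LinearMap.sum_apply]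

namespace LinSystem

variable (L : LinSystem dx dy)

lemma A₂₂_xStar (h : IsUnit L.A₂₂.det) :
    L.A₂₂.toEuclideanLin L.xStar = L.b₂ - L.A₂₁.toEuclideanLin L.yStar := by
  rw [xStar, ← toEuclideanLin_mul_apply, Matrix.mul_nonsing_inv _ h, toEuclideanLin_one_apply]

lemma b₂_sub_eq_zero (h : IsUnit L.A₂₂.det) :
    L.b₂ - L.A₂₁.toEuclideanLin L.yStar - L.A₂₂.toEuclideanLin L.xStar = 0 := by
  rw [L.A₂₂_xStar h, sub_self]

/-- Eliminating `x*` turns the slow equation into `Δ y* = b₁ - A₁₂ A₂₂⁻¹ b₂`, the defining equation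
of `y*`. -/
lemma b₁_sub_eq_zero (hΔ : IsUnit L.Δ.det) :
    L.b₁ - L.A₁₁.toEuclideanLin L.yStar - L.A₁₂.toEuclideanLin L.xStar = 0 := by
  have h1 : L.Δ.toEuclideanLin L.yStar = L.b₁ - (L.A₁₂ * L.A₂₂⁻¹).toEuclideanLin L.b₂ := by
    rw [yStar, ← toEuclideanLin_mul_apply, Matrix.mul_nonsing_inv _ hΔ, toEuclideanLin_one_apply]
  rw [Δ, map_sub, LinearMap.sub_apply, toEuclideanLin_mul_apply] at h1
  rw [xStar, ← toEuclideanLin_mul_apply, map_sub, sub_sub, sub_eq_zero]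
  rw [sub_eq_sub_iff_add_eq_add] at h1
  rw [← add_sub_assoc, eq_sub_iff_add_eq]
  exact h1.symm

/-- The matrix `A` as a continuous linear map between Euclidean spaces. -/
noncomputable abbrev toCLM {m n : ℕ} (A : Matrix (Fin m) (Fin n) ℝ) :
    EuclideanSpace ℝ (Fin n) →L[ℝ] EuclideanSpace ℝ (Fin m) :=
  LinearMap.toContinuousLinearMap A.toEuclideanLin

/-- The linear part of the fast update. -/
noncomputable abbrev fast :
    EuclideanSpace ℝ (Fin dx) × EuclideanSpace ℝ (Fin dy) →L[ℝ]
      EuclideanSpace ℝ (Fin dx) × EuclideanSpace ℝ (Fin dy) :=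
  fastPart (toCLM L.A₂₁) (toCLM L.A₂₂)

/-- The linear part of the slow update. -/
noncomputable abbrev slow :
    EuclideanSpace ℝ (Fin dx) × EuclideanSpace ℝ (Fin dy) →L[ℝ]
      EuclideanSpace ℝ (Fin dx) × EuclideanSpace ℝ (Fin dy) :=
  slowPart (toCLM L.A₁₁) (toCLM L.A₁₂)

end LinSystem

variable {S : Type*} {π : S → ℝ} {N : S → LinSystem dx dy} {L : LinSystem dx dy}

/-- The centered iterates follow a linear recursion on the product space. -/
lemma iterates_succ_sub (a b : ℕ → ℝ) (o : ℕ → S) (x₀ x : EuclideanSpace ℝ (Fin dx))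
    (y₀ y : EuclideanSpace ℝ (Fin dy)) (k : ℕ) :
    iterates N a b o x₀ y₀ (k + 1) - (x, y) = (iterates N a b o x₀ y₀ k - (x, y))
      + a k • ((N (o k)).fast (iterates N a b o x₀ y₀ k - (x, y)) +
        ((N (o k)).b₂ - (N (o k)).A₂₁.toEuclideanLin y - (N (o k)).A₂₂.toEuclideanLin x, 0))
      + b k • ((N (o k)).slow (iterates N a b o x₀ y₀ k - (x, y)) +
        (0, (N (o k)).b₁ - (N (o k)).A₁₁.toEuclideanLin y - (N (o k)).A₁₂.toEuclideanLin x)) := by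
  refine Prod.ext ?_ ?_
  · simp only [iterates, Prod.fst_sub, Prod.fst_add, Prod.smul_fst, fastPart_apply,
      slowPart_apply, LinearMap.coe_toContinuousLinearMap', map_sub, add_zero]
    module
  · simp only [iterates, Prod.snd_add, Prod.smul_snd, Prod.snd_sub, fastPart_apply,
      slowPart_apply, LinearMap.coe_toContinuousLinearMap', map_sub, add_zero]
    module

variable [Fintype S]

lemma IsMean.sum_fast (hN : IsMean π N L) : ∑ s, π s • (N s).fast = L.fast := by
  obtain ⟨-, -, h21, h22, -, -⟩ := hN
  refine ContinuousLinearMap.ext fun z => Prod.ext ?_ ?_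
  · simp [sum_apply, Prod.fst_sum, ← h21, ← h22, Finset.sum_add_distrib, add_comm]
  · simp [sum_apply, Prod.snd_sum]

lemma IsMean.sum_slow (hN : IsMean π N L) : ∑ s, π s • (N s).slow = L.slow := by
  obtain ⟨h11, h12, -, -, -, -⟩ := hN
  refine ContinuousLinearMap.ext fun z => Prod.ext ?_ ?_
  · simp [sum_apply, Prod.fst_sum]
  · simp [sum_apply, Prod.snd_sum, ← h11, ← h12, Finset.sum_add_distrib, add_comm]

lemma IsMean.sum_b₂_sub (hN : IsMean π N L) (x : EuclideanSpace ℝ (Fin dx))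
    (y : EuclideanSpace ℝ (Fin dy)) :
    ∑ s, π s • ((N s).b₂ - (N s).A₂₁.toEuclideanLin y - (N s).A₂₂.toEuclideanLin x) =
      L.b₂ - L.A₂₁.toEuclideanLin y - L.A₂₂.toEuclideanLin x := by
  obtain ⟨-, -, h21, h22, -, hb⟩ := hN
  simp only [smul_sub, Finset.sum_sub_distrib, sum_smul_toEuclideanLin, h21, h22, hb]

lemma IsMean.sum_b₁_sub (hN : IsMean π N L) (x : EuclideanSpace ℝ (Fin dx))
    (y : EuclideanSpace ℝ (Fin dy)) :
    ∑ s, π s • ((N s).b₁ - (N s).A₁₁.toEuclideanLin y - (N s).A₁₂.toEuclideanLin x) =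
      L.b₁ - L.A₁₁.toEuclideanLin y - L.A₁₂.toEuclideanLin x := by
  obtain ⟨h11, h12, -, -, hb, -⟩ := hN
  simp only [smul_sub, Finset.sum_sub_distrib, sum_smul_toEuclideanLin, h11, h12, hb]

end MeanSystem

end TwoTimeScale

/-! ### Mean-square convergence of the two iterates. -/

theorem proposition4 {dx dy : ℕ} {S Ω : Type*}
    [Fintype S] [DecidableEq S] [MeasurableSpace S] [MeasurableSingletonClass S]
    {mΩ : MeasurableSpace Ω} (μ : Measure Ω) [IsProbabilityMeasure μ]
    -- the mean system and the Hurwitz assumption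
    (L : TwoTimeScale.LinSystem dx dy)
    (hA₂₂ : TwoTimeScale.IsHurwitz (-L.A₂₂)) (hΔ : TwoTimeScale.IsHurwitz (-L.Δ))
    -- the Markov chain and the noisy oracle
    (P : Matrix S S ℝ) (hP : P ∈ Matrix.rowStochastic ℝ S)
    (hirr : P.IsIrreducible) (haper : TwoTimeScale.IsAperiodic P)
    (π : S → ℝ) (hπ : TwoTimeScale.IsStationary P π)
    (N : S → TwoTimeScale.LinSystem dx dy) (hN : TwoTimeScale.IsMean π N L)
    (ℱ : Filtration ℕ mΩ) (O : ℕ → Ω → S) (hO : TwoTimeScale.IsMarkovChain μ ℱ P O)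
    -- the initial condition
    (x₀ : Ω → EuclideanSpace ℝ (Fin dx)) (y₀ : Ω → EuclideanSpace ℝ (Fin dy))
    (hx₀ : Measurable[ℱ 0] x₀) (hy₀ : Measurable[ℱ 0] y₀)
    (hx₀' : MemLp x₀ 2 μ) (hy₀' : MemLp y₀ 2 μ)
    -- the step sizes
    (α β ξ : ℝ) (hα : 0 < α) (hβ : 0 < β) (hξ : 1 / 2 < ξ) (hξ' : ξ < 1)
    (a b : ℕ → ℝ) (ha : ∀ k, a k = α / ((k : ℝ) + 1) ^ ξ) (hb : ∀ k, b k = β / ((k : ℝ) + 1)) :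
    TwoTimeScale.TendstoInMeanSquare μ
      (fun k ω => (TwoTimeScale.iterates N a b (fun j => O j ω) (x₀ ω) (y₀ ω) k).1) L.xStar ∧
    TwoTimeScale.TendstoInMeanSquare μ
      (fun k ω => (TwoTimeScale.iterates N a b (fun j => O j ω) (x₀ ω) (y₀ ω) k).2) L.yStar := by
  classical
  obtain ⟨D, hab⟩ := TwoTimeScale.exists_isTwoTimeScaleSteps hα hβ hξ hξ' ha hb
  have hu₂ := TwoTimeScale.isUnit_det_of_isHurwitz_neg hA₂₂
  have huΔ := TwoTimeScale.isUnit_det_of_isHurwitz_neg hΔ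
  obtain ⟨Q₂, c₂, hc₂, hQ₂s, hQ₂p, hQ₂⟩ := TwoTimeScale.exists_lyapunov hA₂₂
  obtain ⟨Q₁, c₁, hc₁, hQ₁s, hQ₁p, hQ₁⟩ := TwoTimeScale.exists_lyapunov hΔ
  obtain ⟨Q, c, hc, hQs, hQc, hdrift⟩ := TwoTimeScale.exists_block_lyapunov
    (T₁₁ := TwoTimeScale.LinSystem.toCLM L.A₁₁) (T₁₂ := TwoTimeScale.LinSystem.toCLM L.A₁₂)
    (T₂₁ := TwoTimeScale.LinSystem.toCLM L.A₂₁) (T₂₂ := TwoTimeScale.LinSystem.toCLM L.A₂₂)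
    (Γ := TwoTimeScale.LinSystem.toCLM (L.A₂₂⁻¹ * L.A₂₁))
    (fun y => by
      simp only [LinearMap.coe_toContinuousLinearMap']
      rw [← TwoTimeScale.toEuclideanLin_mul_apply, Matrix.mul_nonsing_inv_cancel_left _ _ hu₂])
    hQ₂s hQ₁s hQ₂p hQ₁p hc₁ hc₂ hQ₂
    (fun v => by
      have h := hQ₁ v
      rw [TwoTimeScale.LinSystem.Δ, map_sub, LinearMap.sub_apply, Matrix.mul_assoc,
        TwoTimeScale.toEuclideanLin_mul_apply] at h
      exact h)
    hab.fast_pos hab.slow_pos hab.tendsto_slow_div_fast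
  set z := fun k ω => TwoTimeScale.iterates N a b (fun j => O j ω) (x₀ ω) (y₀ ω) k with hz
  have hx2 : MemLp (fun ω => x₀ ω - L.xStar) 2 μ := hx₀'.sub (memLp_const _)
  have hy2 : MemLp (fun ω => y₀ ω - L.yStar) 2 μ := hy₀'.sub (memLp_const _)
  have hw0 : Measurable[ℱ 0] fun ω => z 0 ω - (L.xStar, L.yStar) :=
    (hx₀.sub_const _).prodMk (hy₀.sub_const _)
  have hw2 : MemLp (fun ω => z 0 ω - (L.xStar, L.yStar)) 2 μ := by
    -- The product carries the sup norm, which is at most this sum; conversely it dominates each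
    -- component, so the limit for `w` passes to both.
    have h : MemLp (fun ω => ‖x₀ ω - L.xStar‖ + ‖y₀ ω - L.yStar‖) 2 μ := hx2.norm.add hy2.norm
    refine h.mono (hw0.mono (ℱ.le 0) le_rfl).aestronglyMeasurable
      (Eventually.of_forall fun ω => ?_)
    rw [Real.norm_of_nonneg (by positivity), Prod.norm_def]
    exact max_le_add_of_nonneg (norm_nonneg _) (norm_nonneg _)
  obtain ⟨hmem, hlim⟩ := TwoTimeScale.tendsto_integral_norm_sq_of_drift
    (w := fun k ω => z k ω - (L.xStar, L.yStar)) hP hirr hπ hO hab hQs hc hQc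
    hN.sum_fast hN.sum_slow
    (m := fun s => ((N s).b₂ - (N s).A₂₁.toEuclideanLin L.yStar
      - (N s).A₂₂.toEuclideanLin L.xStar, 0))
    (m' := fun s => (0, (N s).b₁ - (N s).A₁₁.toEuclideanLin L.yStar
      - (N s).A₁₂.toEuclideanLin L.xStar))
    (by
      refine Prod.ext ?_ ?_
      · simpa only [Prod.fst_sum, Prod.smul_fst, Prod.fst_zero, hN.sum_b₂_sub] using
          L.b₂_sub_eq_zero hu₂
      · simp [Prod.snd_sum])
    (by
      refine Prod.ext ?_ ?_
      · simp [Prod.fst_sum]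
      · simpa only [Prod.snd_sum, Prod.smul_snd, Prod.snd_zero, hN.sum_b₁_sub] using
          L.b₁_sub_eq_zero huΔ)
    hdrift hw0 hw2 fun k ω => TwoTimeScale.iterates_succ_sub a b (fun j => O j ω) _ _ _ _ k
  have hx : ∀ k, MemLp (fun ω => (z k ω).1 - L.xStar) 2 μ := fun k => (hmem k).fst
  have hy : ∀ k, MemLp (fun ω => (z k ω).2 - L.yStar) 2 μ := fun k => (hmem k).snd
  refine ⟨⟨fun k => ?_, ?_⟩, ⟨fun k => ?_, ?_⟩⟩
  · simpa [Pi.add_def] using (hx k).add (memLp_const L.xStar)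
  · refine squeeze_zero (fun k => integral_nonneg fun ω => by positivity) (fun k => ?_) hlim
    refine integral_mono (hx k).norm.integrable_sq (hmem k).norm.integrable_sq fun ω => ?_
    exact pow_le_pow_left₀ (norm_nonneg _) (norm_fst_le (z k ω - (L.xStar, L.yStar))) 2
  · simpa [Pi.add_def] using (hy k).add (memLp_const L.yStar)
  · refine squeeze_zero (fun k => integral_nonneg fun ω => by positivity) (fun k => ?_) hlim
    refine integral_mono (hy k).norm.integrable_sq (hmem k).norm.integrable_sq fun ω => ?_
    exact pow_le_pow_left₀ (norm_nonneg _) (norm_snd_le (z k ω - (L.xStar, L.yStar))) 2
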